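/- **Conventions.** Let $G$ be a group with a presentation $\langle X\mid R\rangle$ with $|X|=n<\infty$ (distinct letters of $X$ may represent the same element of $G$). Its Cayley graph $\mathcal G$ is the labelled multigraph with vertex set $G$ and edge set $G\times X$, the edge $(g,x)$ going from $g$ to $gx$. For a finite subgraph $\mathcal H$ of $\mathcal G$ let $\beta_0(\mathcal H)$ be the number of vertices, $\beta_2(\mathcal H)$ the cyclomatic number (number of edges minus number of vertices plus number of components), $\xi(\mathcal H)=\beta_2(\mathcal H)/\beta_0(\mathcal H)$ and, if $\beta_0(\mathcal H)>1$, $\psi(\mathcal H)=\beta_2(\mathcal H)/(\beta_0(\mathcal H)-1)$. An exhausting chain is a sequence $\mathcal G_1\subseteq\mathcal G_2\subseteq\cdots$ of finite connected subgraphs with union $\mathcal G$. Put $$\Xi(G)=\sup_{(\mathcal G_i)}\ \limsup_{i\to\infty}\xi(\mathcal G_i),\qquad \hat\Xi(G)=1-n+\Xi(G),\qquad \Psi(G)=\sup_{\mathcal H}\psi(\mathcal H),$$ where the first supremum is over all exhausting chains and the last one over all finite subgraphs $\mathcal H$ with more than one vertex. All of these depend on the presentation. For $Y\subseteq X$ let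 $Gp(Y)$ be the subgroup of $G$ generated by $Y$; for $H=Gp(Y)$ the quantities $\Xi(H)$, $\Psi(H)$ are taken with respect to the generators $Y$. A presentation is reduced if no generator equals $1$ in $G$, and minimal if $Gp(X')\ne G$ for every proper subset $X'$ of $X$. Call $Y\subseteq X$ extremal if $Gp(Y)$ is finite, $|Y|$ is the largest cardinality of a subset of $X$ generating a finite subgroup, and $|Gp(Y)|$ is least possible among the subsets of that cardinality. **Theorem.** Let $r\ge 2$ and for $1\le i\le r$ let $\langle X_i\mid R_i\rangle$ be a reduced presentation with $n_i=|X_i|<\infty$ generators of a non-trivial group $G_i$, with $\Psi(G_1)\ge\Psi(G_2)\ge\cdots\ge\Psi(G_r)$. Let $n=\sum_i n_i$, and let $G=G_1*\cdots*G_r$ and $G_1*G_2$ have the induced presentations $\langle\bigsqcup_{i\le r} X_i\mid\bigcup_{i\le r} R_i\rangle$ and $\langle X_1\sqcup X_2\mid R_1\cup R_2\rangle$. (i) If $\Psi(G_1)=\Xi(G_1)$ then $\hat\Xi(G)=1-n+\Xi(G_1)$. (ii) Suppose $\Psi(G_1)\neq\Xi(G_1)$. Then $\Psi(G_1)>\Xi(G_1)$,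 and $\hat\Xi(G)=1-n+\Xi(G_1*G_2)$. There is a $Y_1\subseteq X_1$ such that $H_1=Gp(Y_1)$ is finite and non-trivial, $\Psi(G_1)=\Psi(H_1)$, and $$\hat\Xi(G)=1-n+\max\Bigl(\Xi(G_1),\ \Xi(H_1)+\frac{\Psi(G_2)}{|H_1|}\Bigr).\qquad(*)$$ Moreover, $(*)$ holds for $H_1=Gp(Y_1)$ whenever $Y_1\subseteq X_1$ is extremal and $$\Psi(G_1)=\Psi(H_1)=|Y_1|-1+\frac{|Y_1|}{|H_1|-1};\qquad(**)$$ and if the presentation of $G_1$ is minimal, then every extremal $Y_1\subseteq X_1$ satisfies $(**)$. -/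

import Mathlib

namespace CycQuot

open Filter

universe u v

/-- A finite subgraph of the (right) Cayley graph of a group `G` with respect to a family of
generators `gen : ι → G`.  The Cayley graph is the labelled multigraph with vertex set `G` and edge
set `G × ι`, where the edge `(g, x)` goes from `g` to `g * gen x` and has the label `x`.
Two different labels always give different edges, and for a generator of order two the edges
`(g, x)` and `(g * gen x, x)` are different. -/
structure FinSubgraph {G : Type u} [Group G] {ι : Type v} (gen : ι → G) where
  verts : Finset G
  edges : Finset (G × ι)
  src_mem : ∀ e ∈ edges, e.1 ∈ verts
  tgt_mem : ∀ e ∈ edges, e.1 * gen e.2 ∈ verts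

noncomputable section

namespace FinSubgraph

variable {G : Type u} [Group G] {ι : Type v} {gen : ι → G}

/-- The simple graph on the vertices of the subgraph in which two different vertices are adjacent
when some edge of the subgraph joins them; it has the same connected components. -/
def toSimple (H : FinSubgraph gen) : SimpleGraph H.verts :=
  SimpleGraph.fromRel fun a b => ∃ x : ι, (a.1, x) ∈ H.edges ∧ a.1 * gen x = b.1

/-- A finite connected subgraph; it has at least one vertex. -/
def IsConnected (H : FinSubgraph gen) : Prop := H.toSimple.Connected

/-- The number of vertices. -/
def beta0 (H : FinSubgraph gen) : ℕ := H.verts.card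

/-- The number of edges. -/
def beta1 (H : FinSubgraph gen) : ℕ := H.edges.card

/-- The number of connected components. -/
def alpha (H : FinSubgraph gen) : ℕ := Nat.card H.toSimple.ConnectedComponent

/-- The cyclomatic number (the sum of the ranks of the fundamental groups of the components):
the number of edges, minus the number of vertices, plus the number of components. -/
def beta2 (H : FinSubgraph gen) : ℝ := (H.beta1 : ℝ) - (H.beta0 : ℝ) + (H.alpha : ℝ)

/-- `ξ(H) = β₂(H) / β₀(H)`. -/
def xi (H : FinSubgraph gen) : ℝ := H.beta2 / (H.beta0 : ℝ)

/-- `ψ(H) = β₂(H) / (β₀(H) - 1)`, used for graphs with more than one vertex. -/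
def psi (H : FinSubgraph gen) : ℝ := H.beta2 / ((H.beta0 : ℝ) - 1)

end FinSubgraph

section Quotients

variable {G : Type u} [Group G] {ι : Type v}

/-- An exhausting chain: an increasing sequence of finite connected subgraphs of the Cayley graph
whose union is the whole Cayley graph. -/
structure IsExhaustingChain (gen : ι → G) (C : ℕ → FinSubgraph gen) : Prop where
  connected : ∀ i, (C i).IsConnected
  mono_verts : ∀ i, (C i).verts ⊆ (C (i + 1)).verts
  mono_edges : ∀ i, (C i).edges ⊆ (C (i + 1)).edges
  exhaust_verts : ∀ g : G, ∃ i, g ∈ (C i).verts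
  exhaust_edges : ∀ e : G × ι, ∃ i, e ∈ (C i).edges

/-- The cyclomatic quotient `Ξ`: the supremum, over the exhausting chains, of `limsup ξ`.
(For finitely many generators all values of `ξ` lie in `[0, n]`.) -/
def Xi (gen : ι → G) : ℝ :=
  sSup {η : ℝ | ∃ C : ℕ → FinSubgraph gen, IsExhaustingChain gen C ∧
    η = limsup (fun i => (C i).xi) atTop}

/-- The normalized cyclomatic quotient `Ξ̂ = 1 - n + Ξ`, with `n` the number of generators. -/
def XiHat [Fintype ι] (gen : ι → G) : ℝ := 1 - (Fintype.card ι : ℝ) + Xi gen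

/-- `Ψ`: the supremum of `ψ` over all finite subgraphs, connected or not, with more than one
vertex.  (For `n` generators `ψ` is at most `2 * n`.) -/
def Psi (gen : ι → G) : ℝ :=
  sSup {p : ℝ | ∃ H : FinSubgraph gen, 1 < H.beta0 ∧ p = H.psi}

/-- `Gp(Y)`, the subgroup generated by the set `Y` of generators. -/
def Gp (gen : ι → G) (Y : Finset ι) : Subgroup G :=
  Subgroup.closure (gen '' (Y : Set ι))

/-- The generating family of `Gp(Y)` given by the generators in `Y`. -/
def subGen (gen : ι → G) (Y : Finset ι) : Y → Gp gen Y :=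
  fun y => ⟨gen y.1, Subgroup.subset_closure ⟨y.1, y.2, rfl⟩⟩

/-- Among the sets of generators that generate a finite subgroup, `Y` has the largest number of
elements and, among those with that many elements, it generates a subgroup of the least order. -/
def IsExtremal (gen : ι → G) (Y : Finset ι) : Prop :=
  Finite (Gp gen Y) ∧
  (∀ Z : Finset ι, Finite (Gp gen Z) → Z.card ≤ Y.card) ∧
  (∀ Z : Finset ι, Finite (Gp gen Z) → Z.card = Y.card →
    Nat.card (Gp gen Y) ≤ Nat.card (Gp gen Z))

/-- No generator equals the identity. -/
def IsReduced (gen : ι → G) : Prop := ∀ x, gen x ≠ 1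

/-- No proper subset of the generators generates the group. -/
def IsMinimal (gen : ι → G) : Prop :=
  ∀ S : Set ι, S ≠ Set.univ → Subgroup.closure (gen '' S) ≠ ⊤

end Quotients

/-- The generators of the group presented by `⟨α | R⟩`. -/
abbrev gens {α : Type u} (R : Set (FreeGroup α)) : α → PresentedGroup R := PresentedGroup.of

/-- The relators of the induced presentation `⟨⋃ X i | ⋃ R i⟩` of the free product of the groups
`⟨X i | R i⟩`; the union of the generating sets is taken to be disjoint. -/
def freeProductRels {I : Type u} {X : I → Type v} (R : ∀ i, Set (FreeGroup (X i))) :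
    Set (FreeGroup (Σ i, X i)) :=
  ⋃ i, FreeGroup.map (Sigma.mk i) '' R i

end

end CycQuot

/-! For a finite vertex set `S` let `rk S` be the cyclomatic number of the full subgraph on `S`. As
the dimension of a space of rational cycles it is supermodular (`cycleRank_add_le`), and it is
invariant under left translation. Hence a union of translates of a nearly optimal set is still
nearly optimal, and `Xi` is simply the supremum of `rk S / |S|` over nonempty finite `S`
(`rk_le_Xi`, `Xi_le`). Similarly `Psi` is the best constant in `rk S ≤ p (|S| - 1)`. The two
quotients are linked by `profile t`, the supremum of `(rk S + t) / |S|`.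

The central formula is that `Xi` of the free product equals `profile` of `G₁` at `t = Psi G₂`
(`Xi_eq_profile`). For the upper bound, the cosets of the factors form a tree-like pattern, cycles
split into cycles inside cosets, and counting cosets gives `Xi_le_profile_factor`. For the lower
bound, copies of `B ⊆ G₁` and `S ⊆ G₂` are glued into large trees (`exists_tree`).

It remains to evaluate the profile. If `Psi = Xi` for `G₁`, it is squeezed between the two. Where it
exceeds `Xi`, the supremum is attained by sets of bounded size, and two maximizers that meet have a
maximizer as union. A largest maximizer through `1` is therefore a finite subgroup, generated by
some of the generators (`exists_subgroup_rk_add_eq`); its value is `Xi H + t / |H|`. Only the first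
two factors enter the formula, so `G₁ * G₂` gives the same value. -/

namespace CycQuot
noncomputable section
open scoped Classical

/-! ### Rational cycle spaces of multigraphs -/

section CycleSpace

open Module

variable {V E V' E' K : Type*}

/-- The boundary map of a directed multigraph with source map `s` and target map `t`. -/
def boundary (s t : E → V) : (E →₀ ℚ) →ₗ[ℚ] (V →₀ ℚ) :=
  Finsupp.lmapDomain ℚ ℚ t - Finsupp.lmapDomain ℚ ℚ s

/-- The rational cycles supported on a set of edges. -/
def cycleSpace (s t : E → V) (A : Set E) : Submodule ℚ (E →₀ ℚ) :=
  Finsupp.supported ℚ ℚ A ⊓ LinearMap.ker (boundary s t)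

/-- The dimension of the space of cycles supported on a finite set of edges. -/
def cycleRank (s t : E → V) (A : Finset E) : ℕ := finrank ℚ (cycleSpace s t (A : Set E))

variable {s t : E → V}

theorem mem_cycleSpace {A : Set E} {f : E →₀ ℚ} :
    f ∈ cycleSpace s t A ↔ (f.support : Set E) ⊆ A ∧ f.mapDomain t = f.mapDomain s := by
  simp [cycleSpace, boundary, Finsupp.mem_supported, sub_eq_zero]

instance finiteDimensional_supported (A : Finset E) :
    FiniteDimensional ℚ (Finsupp.supported ℚ ℚ (A : Set E)) :=
  (Finsupp.supportedEquivFinsupp (M := ℚ) (R := ℚ) (A : Set E)).symm.finiteDimensional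

theorem finrank_supported (A : Finset E) :
    finrank ℚ (Finsupp.supported ℚ ℚ (A : Set E)) = A.card := by
  rw [(Finsupp.supportedEquivFinsupp (M := ℚ) (R := ℚ) (A : Set E)).finrank_eq]
  simp

instance finiteDimensional_cycleSpace (A : Finset E) :
    FiniteDimensional ℚ (cycleSpace s t (A : Set E)) :=
  Submodule.finiteDimensional_inf_left _ _

theorem cycleRank_le_card (A : Finset E) : cycleRank s t A ≤ A.card := by
  rw [← finrank_supported A]
  exact Submodule.finrank_mono inf_le_left

theorem cycleSpace_mono {A B : Set E} (h : A ⊆ B) : cycleSpace s t A ≤ cycleSpace s t B :=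
  inf_le_inf_right _ (Finsupp.supported_mono h)

theorem cycleRank_mono {A B : Finset E} (h : A ⊆ B) : cycleRank s t A ≤ cycleRank s t B :=
  Submodule.finrank_mono (cycleSpace_mono (Finset.coe_subset.2 h))

theorem cycleRank_empty : cycleRank s t (∅ : Finset E) = 0 := by
  simpa using cycleRank_le_card (s := s) (t := t) (∅ : Finset E)

/-- Cycles on `A` and on `B` span a subspace of the cycles on `A ∪ B` and meet inside the cycles on
`A ∩ B`; the rest is the dimension formula. -/
theorem cycleRank_add_le [DecidableEq E] (A B : Finset E) :
    cycleRank s t A + cycleRank s t B ≤ cycleRank s t (A ∪ B) + cycleRank s t (A ∩ B) := by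
  unfold cycleRank
  rw [← Submodule.finrank_sup_add_finrank_inf_eq]
  refine Nat.add_le_add (Submodule.finrank_mono ?_) (Submodule.finrank_mono ?_)
  · exact sup_le (cycleSpace_mono (by simp)) (cycleSpace_mono (by simp))
  · rintro f ⟨⟨h1, h2⟩, h3, -⟩
    refine ⟨?_, h2⟩
    rw [Finset.coe_inter, Finsupp.supported_inter]
    exact ⟨h1, h3⟩

theorem sum_cycleRank_le {I : Finset K} {A : K → Finset E} {B : Finset E}
    (hd : (I : Set K).PairwiseDisjoint A) (hB : ∀ i ∈ I, A i ⊆ B) :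
    ∑ i ∈ I, cycleRank s t (A i) ≤ cycleRank s t B := by
  refine le_trans ?_ (cycleRank_mono (Finset.biUnion_subset.2 hB))
  induction I using Finset.induction_on with
  | empty => simp
  | insert a I ha ih =>
    rw [Finset.sum_insert ha, Finset.biUnion_insert]
    have h := cycleRank_add_le (s := s) (t := t) (A a) (I.biUnion A)
    have h0 : A a ∩ I.biUnion A = ∅ := by
      rw [← Finset.disjoint_iff_inter_eq_empty, Finset.disjoint_biUnion_right]
      intro i hi
      exact hd (by simp) (by simp [hi]) (by rintro rfl; exact ha hi)
    rw [h0, cycleRank_empty] at h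
    have := ih (hd.subset (by simp)) (fun i hi => hB i (by simp [hi]))
    omega

theorem cycleRank_image [DecidableEq E'] {s' t' : E' → V'} {φ : E → E'} {θ : V → V'}
    (hφ : φ.Injective) (hθ : θ.Injective) (hs : ∀ e, s' (φ e) = θ (s e))
    (ht : ∀ e, t' (φ e) = θ (t e)) (A : Finset E) :
    cycleRank s' t' (A.image φ) = cycleRank s t A := by
  unfold cycleRank
  have hinj : Function.Injective (Finsupp.lmapDomain ℚ ℚ φ) := Finsupp.mapDomain_injective hφ
  have hb : ∀ f : E →₀ ℚ, (Finsupp.mapDomain φ f).mapDomain t' =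
      (Finsupp.mapDomain φ f).mapDomain s' ↔ f.mapDomain t = f.mapDomain s := by
    intro f
    rw [← Finsupp.mapDomain_comp, ← Finsupp.mapDomain_comp,
      show t' ∘ φ = θ ∘ t from funext ht, show s' ∘ φ = θ ∘ s from funext hs,
      Finsupp.mapDomain_comp, Finsupp.mapDomain_comp]
    exact (Finsupp.mapDomain_injective hθ).eq_iff
  have hmap : (cycleSpace s t (A : Set E)).map (Finsupp.lmapDomain ℚ ℚ φ) =
      cycleSpace s' t' ((A.image φ : Finset E') : Set E') := by
    ext g
    constructor
    · rintro ⟨f, hf, rfl⟩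
      rw [SetLike.mem_coe, mem_cycleSpace] at hf
      rw [Finsupp.lmapDomain_apply, mem_cycleSpace, hb]
      refine ⟨fun e he => ?_, hf.2⟩
      have := Finsupp.mapDomain_support he
      obtain ⟨e', he', rfl⟩ := Finset.mem_image.1 this
      rw [Finset.coe_image]
      exact ⟨e', hf.1 he', rfl⟩
    · rintro ⟨h1, h2⟩
      rw [Finset.coe_image, ← Finsupp.lmapDomain_supported] at h1
      obtain ⟨f, hf, rfl⟩ := h1
      refine ⟨f, ⟨hf, ?_⟩, rfl⟩
      rw [SetLike.mem_coe, LinearMap.mem_ker, boundary, LinearMap.sub_apply, sub_eq_zero] at h2 ⊢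
      exact (hb f).1 h2
  rw [← hmap, ← (Submodule.equivMapOfInjective _ hinj _).finrank_eq]

/-- If a map of the vertices collapses the edges outside of one colour and is a retraction onto
the edges of that colour, then the part of a cycle with that colour is a cycle. -/
theorem filter_mem_cycleSpace {A : Set E} {f : E →₀ ℚ} (hf : f ∈ cycleSpace s t A)
    (p : E → Prop) [DecidablePred p] (γ : V → V) (hp : ∀ e ∈ A, p e → γ (s e) = s e ∧ γ (t e) = t e)
    (hnp : ∀ e ∈ A, ¬ p e → γ (s e) = γ (t e)) :
    f.filter p ∈ cycleSpace s t {e | e ∈ A ∧ p e} := by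
  rw [mem_cycleSpace] at hf ⊢
  obtain ⟨hA, hf⟩ := hf
  refine ⟨fun e he => ?_, ?_⟩
  · simp only [Finsupp.support_filter, Finset.coe_filter, Set.mem_ofPred_eq] at he
    exact ⟨hA he.1, he.2⟩
  -- Pushing the cycle equation forward along `γ` cancels the edges outside `p`, which `γ`
  -- collapses, and leaves the ends of the other edges unchanged.
  · have key : (f.mapDomain t).mapDomain γ = (f.mapDomain s).mapDomain γ := by rw [hf]
    rw [← Finsupp.mapDomain_comp, ← Finsupp.mapDomain_comp] at key
    rw [← Finsupp.filter_add_filter_not f p, Finsupp.mapDomain_add, Finsupp.mapDomain_add] at key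
    have h1 : (f.filter fun a => ¬ p a).mapDomain (γ ∘ t) =
        (f.filter fun a => ¬ p a).mapDomain (γ ∘ s) := by
      refine Finsupp.mapDomain_congr fun e he => ?_
      simp only [Finsupp.support_filter, Finset.mem_filter] at he
      exact (hnp e (hA he.1) he.2).symm
    rw [h1, add_left_inj] at key
    have h2 : ∀ g : E → V, (∀ e ∈ A, p e → γ (g e) = g e) →
        (f.filter p).mapDomain (γ ∘ g) = (f.filter p).mapDomain g := by
      intro g hg
      refine Finsupp.mapDomain_congr fun e he => ?_
      simp only [Finsupp.support_filter, Finset.mem_filter] at he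
      exact hg e (hA he.1) he.2
    rwa [h2 t fun e he h => (hp e he h).2, h2 s fun e he h => (hp e he h).1] at key

/-- Splitting a cycle by colour is injective, and the retraction `γ k` guarantees that the part of
colour `k` is again a cycle. -/
theorem cycleRank_le_sum [DecidableEq K] (A : Finset E) (κ : E → K) (γ : K → V → V)
    (h : ∀ e ∈ A, γ (κ e) (s e) = s e ∧ γ (κ e) (t e) = t e)
    (h' : ∀ k ∈ A.image κ, ∀ e ∈ A, κ e ≠ k → γ k (s e) = γ k (t e)) :
    cycleRank s t A ≤ ∑ k ∈ A.image κ, cycleRank s t (A.filter fun e => κ e = k) := by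
  rw [← Finset.sum_coe_sort]
  unfold cycleRank
  rw [← finrank_pi_fintype]
  have hmem : ∀ (k : A.image κ) (f : cycleSpace s t (A : Set E)),
      f.1.filter (fun e => κ e = k) ∈
        cycleSpace s t ((A.filter fun e => κ e = k : Finset E) : Set E) := by
    intro k f
    rw [Finset.coe_filter]
    refine filter_mem_cycleSpace f.2 _ (γ k) ?_ (h' k k.2)
    intro e he hk
    rw [← hk]
    exact h e he
  let Φ : cycleSpace s t (A : Set E) →ₗ[ℚ]
      ((k : A.image κ) → cycleSpace s t ((A.filter fun e => κ e = k : Finset E) : Set E)) :=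
    { toFun := fun f k => ⟨_, hmem k f⟩
      map_add' := fun f g => by ext k; simp [Finsupp.filter_add]
      map_smul' := fun c f => by ext k; simp [Finsupp.filter_smul] }
  refine LinearMap.finrank_le_finrank_of_injective (f := Φ) ?_
  rw [← LinearMap.ker_eq_bot, LinearMap.ker_eq_bot']
  intro f hf
  ext e
  by_cases he : e ∈ A
  · have := congrArg (fun g => g.1 e) (congrFun hf ⟨κ e, Finset.mem_image_of_mem κ he⟩)
    simpa [Φ] using this
  · have : e ∉ f.1.support := fun h => he ((mem_cycleSpace.1 f.2).1 h)
    simpa using this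

/-- The functions on the vertices that are constant along the edges. -/
def locallyConstant (s t : E → V) (S : Finset V) (A : Finset E) : Submodule ℚ (S → ℚ) where
  carrier := {φ | ∀ e ∈ A, ∀ (h₁ : s e ∈ S) (h₂ : t e ∈ S), φ ⟨t e, h₂⟩ = φ ⟨s e, h₁⟩}
  add_mem' := fun ha hb e he h₁ h₂ => by simp [ha e he h₁ h₂, hb e he h₁ h₂]
  zero_mem' := fun _ _ _ _ => rfl
  smul_mem' := fun c a ha e he h₁ h₂ => by simp [ha e he h₁ h₂]

/-- The incidence matrix has the locally constant functions as kernel, and its transpose has the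
cycles as kernel. Both have the same rank, so two applications of rank-nullity give the identity. -/
theorem card_add_finrank_locallyConstant (S : Finset V) (A : Finset E)
    (hs : ∀ e ∈ A, s e ∈ S) (ht : ∀ e ∈ A, t e ∈ S) :
    A.card + finrank ℚ (locallyConstant s t S A) = cycleRank s t A + S.card := by
  let M : Matrix A S ℚ := fun e v => (if t e = v then 1 else 0) - (if s e = v then 1 else 0)
  have hM : ∀ φ e, M.mulVec φ e = φ ⟨t e, ht e e.2⟩ - φ ⟨s e, hs e e.2⟩ := by
    intro φ e
    have h : ∀ v : V, ∀ hv : v ∈ S, ∑ x : S, (if v = x then (1 : ℚ) else 0) * φ x = φ ⟨v, hv⟩ := by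
      intro v hv
      rw [Finset.sum_eq_single ⟨v, hv⟩]
      · simp
      · intro b _ hb
        rw [if_neg (fun h => hb (Subtype.ext h.symm)), zero_mul]
      · simp
    simp only [M, Matrix.mulVec, dotProduct, sub_mul, Finset.sum_sub_distrib]
    rw [h _ (ht e e.2), h _ (hs e e.2)]
  have h1 : LinearMap.ker M.mulVecLin = locallyConstant s t S A := by
    ext φ
    rw [LinearMap.mem_ker, Matrix.mulVecLin_apply]
    constructor
    · intro h e he h₁ h₂
      have := congrFun h ⟨e, he⟩
      rw [hM] at this
      exact sub_eq_zero.1 this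
    · intro h
      ext e
      rw [hM]
      exact sub_eq_zero.2 (h e e.2 _ _)
  have h2 : finrank ℚ (LinearMap.ker M.transpose.mulVecLin) = cycleRank s t A := by
    let Θ : (A → ℚ) →ₗ[ℚ] (E →₀ ℚ) :=
      (Finsupp.lmapDomain ℚ ℚ (Subtype.val : A → E)).comp
        (Finsupp.linearEquivFunOnFinite ℚ ℚ A).symm.toLinearMap
    have hΘ : Function.Injective Θ :=
      (Finsupp.mapDomain_injective Subtype.val_injective).comp (LinearEquiv.injective _)
    have hrange : LinearMap.range Θ = Finsupp.supported ℚ ℚ (A : Set E) := by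
      rw [LinearMap.range_comp_of_range_eq_top _ (LinearEquiv.range _), ← Submodule.map_top,
        ← Finsupp.supported_univ, Finsupp.lmapDomain_supported]
      simp
    have hsum : ∀ v, Θ v = ∑ e : A, Finsupp.single e.1 (v e) := by
      intro v
      simp only [Θ, LinearMap.comp_apply, LinearEquiv.coe_coe, Finsupp.lmapDomain_apply]
      rw [Finsupp.mapDomain, Finsupp.sum_fintype _ _ (by simp)]
      simp
    have hbd : ∀ v u, boundary s t (Θ v) u =
        ∑ e : A, ((if t e = u then 1 else 0) - (if s e = u then 1 else 0)) * v e := by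
      intro v u
      rw [hsum, map_sum, Finsupp.finsetSum_apply]
      refine Finset.sum_congr rfl fun e _ => ?_
      simp [boundary, Finsupp.mapDomain_single, Finsupp.single_apply, sub_mul]
    have hker : ∀ v, M.transpose.mulVecLin v = 0 ↔ boundary s t (Θ v) = 0 := by
      intro v
      constructor
      · intro h
        ext u
        rw [hbd]
        by_cases hu : u ∈ S
        · exact congrFun h ⟨u, hu⟩
        · refine Finset.sum_eq_zero fun e _ => ?_
          have h1 : t e ≠ u := by rintro rfl; exact hu (ht e e.2)
          have h2 : s e ≠ u := by rintro rfl; exact hu (hs e e.2)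
          simp [h1, h2]
      · intro h
        ext u
        have := DFunLike.congr_fun h u.1
        rwa [hbd] at this
    have hmap : (LinearMap.ker M.transpose.mulVecLin).map Θ = cycleSpace s t (A : Set E) := ?_
    · rw [cycleRank, ← hmap, (Submodule.equivMapOfInjective Θ hΘ _).finrank_eq]
    ext f
    constructor
    · rintro ⟨v, hv, rfl⟩
      exact ⟨hrange ▸ LinearMap.mem_range_self Θ v, (hker v).1 hv⟩
    · rintro ⟨h1, h2⟩
      rw [← hrange] at h1
      obtain ⟨v, rfl⟩ := h1
      exact ⟨v, (hker v).2 h2, rfl⟩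
  have r1 := LinearMap.finrank_range_add_finrank_ker M.mulVecLin
  have r2 := LinearMap.finrank_range_add_finrank_ker M.transpose.mulVecLin
  have r3 : finrank ℚ (LinearMap.range M.transpose.mulVecLin) =
    finrank ℚ (LinearMap.range M.mulVecLin) := Matrix.rank_transpose M
  rw [h1] at r1
  rw [h2, r3] at r2
  simp only [finrank_fintype_fun_eq_card, Fintype.card_coe] at r1 r2
  omega

end CycleSpace

/-! ### Cyclomatic numbers in Cayley graphs -/

section CayleyGraph

open Module

variable {G : Type*} [Group G] {ι : Type*} {gen : ι → G}

/-- The target of an edge of the Cayley graph. -/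
def target (gen : ι → G) (e : G × ι) : G := e.1 * gen e.2

theorem FinSubgraph.finrank_locallyConstant (H : FinSubgraph gen) :
    finrank ℚ (locallyConstant Prod.fst (target gen) H.verts H.edges) = H.alpha := by
  have : Fintype H.toSimple.ConnectedComponent := Fintype.ofFinite _
  rw [FinSubgraph.alpha, Nat.card_eq_fintype_card,
    ← finrank_fintype_fun_eq_card (R := ℚ) (η := H.toSimple.ConnectedComponent)]
  have key : ∀ φ ∈ locallyConstant Prod.fst (target gen) H.verts H.edges, ∀ a b : H.verts,
      H.toSimple.Adj a b → φ a = φ b := by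
    intro φ hφ a b hab
    obtain ⟨-, ⟨x, hx, hb⟩ | ⟨x, hx, hb⟩⟩ := (SimpleGraph.fromRel_adj _ _ _).1 hab
    · have := hφ (a.1, x) hx a.2 (hb.symm ▸ b.2 : a.1 * gen x ∈ H.verts)
      rw [← this]
      congr 1
      exact Subtype.ext hb
    · have := hφ (b.1, x) hx b.2 (hb.symm ▸ a.2 : b.1 * gen x ∈ H.verts)
      rw [← this]
      congr 1
      exact Subtype.ext hb.symm
  let Φ : (H.toSimple.ConnectedComponent → ℚ) →ₗ[ℚ] (H.verts → ℚ) :=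
    LinearMap.funLeft ℚ ℚ H.toSimple.connectedComponentMk
  have hΦ : Function.Injective Φ :=
    LinearMap.funLeft_injective_of_surjective _ _ _ Quot.mk_surjective
  have hrange : locallyConstant Prod.fst (target gen) H.verts H.edges = LinearMap.range Φ := ?_
  · rw [hrange, LinearMap.finrank_range_of_inj hΦ]
  ext φ
  constructor
  · intro hφ
    exact ⟨Quot.lift φ fun a b ⟨p⟩ => p.rec rfl
      (fun hab _ ih => (key φ hφ _ _ hab).trans ih), rfl⟩
  · rintro ⟨ψ, rfl⟩ e he h₁ h₂
    change ψ _ = ψ _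
    congr 1
    rw [SimpleGraph.ConnectedComponent.eq]
    by_cases h : e.1 = target gen e
    · rw [show (⟨target gen e, h₂⟩ : H.verts) = ⟨e.1, h₁⟩ from Subtype.ext h.symm]
    · refine SimpleGraph.Adj.reachable (SimpleGraph.Adj.symm ?_)
      refine (SimpleGraph.fromRel_adj _ _ _).2 ⟨fun h' => h (congrArg Subtype.val h'), Or.inl ?_⟩
      exact ⟨e.2, he, rfl⟩

theorem FinSubgraph.beta2_eq (H : FinSubgraph gen) :
    H.beta2 = cycleRank Prod.fst (target gen) H.edges := by
  have h := card_add_finrank_locallyConstant (t := target gen) H.verts H.edges H.src_mem H.tgt_mem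
  rw [H.finrank_locallyConstant] at h
  rw [FinSubgraph.beta2, FinSubgraph.beta1, FinSubgraph.beta0]
  have : ((H.edges.card + H.alpha : ℕ) : ℝ) = (_ : ℕ) := congrArg _ h
  push_cast at this
  linarith

/-- A nonempty set of vertices on which every predicate that is invariant along the edges of the
full subgraph is constant. -/
def IsConn (gen : ι → G) (S : Finset G) : Prop :=
  S.Nonempty ∧ ∀ P : G → Prop, (∀ g ∈ S, ∀ x, g * gen x ∈ S → (P g ↔ P (g * gen x))) →
    ∀ a ∈ S, ∀ b ∈ S, P a → P b

theorem IsConn.union {A B : Finset G} (hA : IsConn gen A) (hB : IsConn gen B)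
    (hAB : (A ∩ B).Nonempty) : IsConn gen (A ∪ B) := by
  refine ⟨hA.1.mono Finset.subset_union_left, fun P hP => ?_⟩
  obtain ⟨v, hv⟩ := hAB
  rw [Finset.mem_inter] at hv
  have h1 := hA.2 P fun g hg x hx => hP g (Finset.mem_union_left _ hg) x (Finset.mem_union_left _ hx)
  have h2 := hB.2 P fun g hg x hx =>
    hP g (Finset.mem_union_right _ hg) x (Finset.mem_union_right _ hx)
  intro a ha b hb hPa
  have hPv : P v := by
    rcases Finset.mem_union.1 ha with ha | ha
    · exact h1 a ha v hv.1 hPa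
    · exact h2 a ha v hv.2 hPa
  rcases Finset.mem_union.1 hb with hb | hb
  · exact h1 v hv.1 b hb hPv
  · exact h2 v hv.2 b hb hPv

theorem IsConn.image_mul {S : Finset G} (h : IsConn gen S) (g : G) :
    IsConn gen (S.image (g * ·)) := by
  refine ⟨h.1.image _, fun P hP => ?_⟩
  have := h.2 (fun v => P (g * v)) fun v hv x hx => by
    rw [← mul_assoc]
    refine hP _ (Finset.mem_image_of_mem _ hv) x ?_
    rw [mul_assoc]
    exact Finset.mem_image_of_mem (g * ·) hx
  simpa only [Finset.forall_mem_image] using this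

theorem isConn_singleton (g : G) : IsConn gen {g} :=
  ⟨Finset.singleton_nonempty g, by simp⟩

theorem isConn_univ [Fintype G] (h : Subgroup.closure (Set.range gen) = ⊤) :
    IsConn gen Finset.univ := by
  refine ⟨Finset.univ_nonempty, fun P hP a _ b _ hPa => ?_⟩
  have : ∀ c ∈ Subgroup.closure (Set.range gen), ∀ g, P g ↔ P (g * c) := by
    intro c hc
    induction hc using Subgroup.closure_induction with
    | mem c hc =>
      obtain ⟨x, rfl⟩ := hc
      exact fun g => hP g (Finset.mem_univ _) x (Finset.mem_univ _)
    | one => simp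
    | mul c d _ _ h1 h2 =>
      intro g
      rw [h1 g, h2, mul_assoc]
    | inv c _ h1 =>
      intro g
      rw [h1 (g * c⁻¹), inv_mul_cancel_right]
  simpa using (this (a⁻¹ * b) (h ▸ Subgroup.mem_top _) a).1 hPa

variable [Fintype ι]

/-- The full subgraph of the Cayley graph on a finite set of vertices. -/
def fullSubgraph (gen : ι → G) (S : Finset G) : FinSubgraph gen where
  verts := S
  edges := (S ×ˢ Finset.univ).filter fun e => e.1 * gen e.2 ∈ S
  src_mem := by simp +contextual
  tgt_mem := by simp +contextual

/-- The cyclomatic number of the full subgraph on a finite set of vertices. -/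
def rk (gen : ι → G) (S : Finset G) : ℕ :=
  cycleRank Prod.fst (target gen) (fullSubgraph gen S).edges

theorem mem_fullSubgraph_edges {S : Finset G} {e : G × ι} :
    e ∈ (fullSubgraph gen S).edges ↔ e.1 ∈ S ∧ e.1 * gen e.2 ∈ S := by
  simp [fullSubgraph]

theorem beta2_fullSubgraph (S : Finset G) : (fullSubgraph gen S).beta2 = rk gen S :=
  FinSubgraph.beta2_eq _

/-- More edges on the same vertices allow more cycles, so full subgraphs suffice for all the
suprema. -/
theorem FinSubgraph.beta2_le (H : FinSubgraph gen) : H.beta2 ≤ rk gen H.verts := by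
  rw [H.beta2_eq, Nat.cast_le]
  exact cycleRank_mono fun e he => mem_fullSubgraph_edges.2 ⟨H.src_mem e he, H.tgt_mem e he⟩

theorem rk_add_le (A B : Finset G) :
    rk gen A + rk gen B ≤ rk gen (A ∪ B) + rk gen (A ∩ B) := by
  refine (cycleRank_add_le _ _).trans (Nat.add_le_add (cycleRank_mono ?_) (cycleRank_mono ?_))
  · intro e
    simp only [Finset.mem_union, mem_fullSubgraph_edges]
    tauto
  · intro e
    simp only [Finset.mem_inter, mem_fullSubgraph_edges]
    tauto

theorem rk_empty : rk gen ∅ = 0 := by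
  have : (fullSubgraph gen ∅).edges = ∅ := by ext; simp [mem_fullSubgraph_edges]
  rw [rk, this, cycleRank_empty]

theorem rk_le (S : Finset G) : rk gen S ≤ Fintype.card ι * S.card := by
  refine (cycleRank_le_card _).trans ((Finset.card_filter_le _ _).trans ?_)
  rw [Finset.card_product, Finset.card_univ, mul_comm]

theorem rk_singleton (h : IsReduced gen) (g : G) : rk gen {g} = 0 := by
  have : (fullSubgraph gen {g}).edges = ∅ := by
    ext e
    simp only [mem_fullSubgraph_edges, Finset.mem_singleton, Finset.notMem_empty, iff_false]
    rintro ⟨rfl, h'⟩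
    exact h _ (by simpa using h')
  rw [rk, this, cycleRank_empty]

theorem rk_le_filter_add (S : Finset G) (P : G → Prop)
    (hP : ∀ g ∈ S, ∀ x, g * gen x ∈ S → (P g ↔ P (g * gen x))) :
    rk gen S ≤ rk gen (S.filter P) + rk gen (S.filter fun g => ¬ P g) := by
  rcases S.eq_empty_or_nonempty with rfl | ⟨v, hv⟩
  · simp [rk_empty]
  -- The retraction for colour `k` fixes the vertices of that colour and sends all others to one
  -- arbitrary vertex `v`.
  have hle := cycleRank_le_sum (s := Prod.fst) (t := target gen) (fullSubgraph gen S).edges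
    (fun e => P e.1) (fun k u => if (P u ↔ k) then u else v) ?_ ?_
  · refine hle.trans ?_
    have h1 : ∀ k : Prop, (fullSubgraph gen S).edges.filter (fun e => P e.1 = k) ⊆
        (fullSubgraph gen (S.filter fun g => P g ↔ k)).edges := by
      intro k e
      simp only [Finset.mem_filter, mem_fullSubgraph_edges, eq_iff_iff]
      rintro ⟨⟨h1, h2⟩, h3⟩
      exact ⟨⟨h1, h3⟩, h2, (hP _ h1 _ h2).symm.trans h3⟩
    refine (Finset.sum_le_sum fun k _ => cycleRank_mono (h1 k)).trans ?_
    refine (Finset.sum_le_sum_of_subset (t := {True, False}) ?_).trans ?_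
    · intro k _
      by_cases hk : k <;> simp [hk]
    · rw [Finset.sum_pair (by simp)]
      simp [rk]
  · rintro ⟨g, x⟩ he
    obtain ⟨h1, h2⟩ := mem_fullSubgraph_edges.1 he
    exact ⟨if_pos Iff.rfl, if_pos (hP g h1 x h2).symm⟩
  · rintro k - ⟨g, x⟩ he hk
    obtain ⟨h1, h2⟩ := mem_fullSubgraph_edges.1 he
    have h3 : ¬ (P g ↔ k) := fun h => hk (propext h)
    have h4 : ¬ (P (target gen (g, x)) ↔ k) := fun h => h3 ((hP g h1 x h2).trans h)
    exact (if_neg h3).trans (if_neg h4).symm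

theorem rk_image_mul (g : G) (S : Finset G) : rk gen (S.image (g * ·)) = rk gen S := by
  have : (fullSubgraph gen (S.image (g * ·))).edges =
      (fullSubgraph gen S).edges.image (Prod.map (g * ·) id) := by
    ext ⟨h, x⟩
    simp only [mem_fullSubgraph_edges, Finset.mem_image, Prod.exists, Prod.map_apply, id,
      Prod.mk.injEq]
    constructor
    · rintro ⟨⟨a, ha, rfl⟩, b, hb, hab⟩
      rw [mul_assoc, mul_left_cancel_iff] at hab
      exact ⟨a, x, ⟨ha, hab ▸ hb⟩, rfl, rfl⟩
    · rintro ⟨a, y, ⟨ha, hb⟩, rfl, rfl⟩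
      exact ⟨⟨a, ha, rfl⟩, _, hb, (mul_assoc _ _ _).symm⟩
  rw [rk, this]
  exact cycleRank_image (s := Prod.fst) (t := target gen) (s' := Prod.fst) (t' := target gen)
    (θ := fun v => g * v) ((mul_right_injective g).prodMap Function.injective_id)
    (mul_right_injective g) (fun _ => rfl) (fun _ => mul_assoc _ _ _) _

theorem IsConn.isConnected {S : Finset G} (h : IsConn gen S) :
    (fullSubgraph gen S).IsConnected := by
  obtain ⟨⟨v, hv⟩, h⟩ := h
  have : Nonempty (fullSubgraph gen S).verts := ⟨⟨v, hv⟩⟩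
  refine SimpleGraph.Connected.mk fun a b => ?_
  refine (h (fun g => ∃ hg : g ∈ S, (fullSubgraph gen S).toSimple.Reachable a ⟨g, hg⟩)
    ?_ a a.2 b b.2 ⟨a.2, SimpleGraph.Reachable.rfl⟩).elim fun _ h => h
  · intro g hg x hgx
    have : (fullSubgraph gen S).toSimple.Reachable ⟨g, hg⟩ ⟨g * gen x, hgx⟩ := by
      by_cases hne : g = g * gen x
      · have : (⟨g, hg⟩ : (fullSubgraph gen S).verts) = ⟨g * gen x, hgx⟩ := Subtype.ext hne
        exact this ▸ SimpleGraph.Reachable.rfl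
      · exact SimpleGraph.Adj.reachable ((SimpleGraph.fromRel_adj _ _ _).2
          ⟨fun h' => hne (congrArg Subtype.val h'), Or.inl ⟨x, mem_fullSubgraph_edges.2 ⟨hg, hgx⟩, rfl⟩⟩)
    exact ⟨fun ⟨_, h⟩ => ⟨hgx, h.trans this⟩, fun ⟨_, h⟩ => ⟨hg, h.trans this.symm⟩⟩

theorem IsConn.rk_add_card {S : Finset G} (h : IsConn gen S) :
    rk gen S + S.card = (fullSubgraph gen S).edges.card + 1 := by
  have h1 := card_add_finrank_locallyConstant (t := target gen) (fullSubgraph gen S).verts (fullSubgraph gen S).edges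
    (fullSubgraph gen S).src_mem (fullSubgraph gen S).tgt_mem
  rw [FinSubgraph.finrank_locallyConstant] at h1
  have h2 : (fullSubgraph gen S).alpha = 1 := by
    have := h.isConnected.preconnected.subsingleton_connectedComponent
    have := h.isConnected.nonempty
    exact Nat.card_eq_one_iff_unique.2 ⟨inferInstance, inferInstance⟩
  rw [h2] at h1
  exact h1.symm

theorem rk_univ_add_card [Fintype G] (h : Subgroup.closure (Set.range gen) = ⊤) :
    rk gen Finset.univ + Fintype.card G = Fintype.card G * Fintype.card ι + 1 := by
  have := (isConn_univ h).rk_add_card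
  rwa [show (fullSubgraph gen Finset.univ).edges = Finset.univ by ext; simp [mem_fullSubgraph_edges],
    Finset.card_univ, Finset.card_univ, Fintype.card_prod] at this

end CayleyGraph

/-! ### Comparison along injective homomorphisms -/

section Hom

variable {G : Type*} [Group G] {ι : Type*} {gen : ι → G}
  {M : Type*} [Group M] {κ : Type*} [Fintype κ] {gen' : κ → M}

theorem cycleRank_image_hom [DecidableEq (G × ι)] (f : M →* G) (hf : Function.Injective f) (j : κ → ι)
    (hj : Function.Injective j) (h : ∀ x, gen (j x) = f (gen' x)) (g : G) (S : Finset M) :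
    cycleRank Prod.fst (target gen)
      ((fullSubgraph gen' S).edges.image (Prod.map (fun v => g * f v) j)) = rk gen' S :=
  cycleRank_image (s := Prod.fst) (t := target gen') (s' := Prod.fst) (t' := target gen)
    (θ := fun v => g * f v) (((mul_right_injective g).comp hf).prodMap hj) ((mul_right_injective g).comp hf)
    (fun _ => rfl) (fun e => by simp [target, h, mul_assoc]) _

variable [Fintype ι]

theorem rk_le_rk_image_hom (f : M →* G) (hf : Function.Injective f) (j : κ → ι)
    (hj : Function.Injective j) (h : ∀ x, gen (j x) = f (gen' x)) (S : Finset M) :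
    rk gen' S ≤ rk gen (S.image f) := by
  rw [← cycleRank_image_hom f hf j hj h 1]
  refine cycleRank_mono ?_
  simp only [Finset.subset_iff, Finset.mem_image, Prod.exists, mem_fullSubgraph_edges]
  rintro _ ⟨a, x, ⟨ha, hb⟩, rfl⟩
  simp only [Prod.map_apply, one_mul, h, ← map_mul]
  exact ⟨⟨a, ha, rfl⟩, _, hb, rfl⟩

/-- An additional edge between image vertices would carry a label whose generator lies in `f.range`;
`hfull` says that all such labels come from `j`. -/
theorem rk_image_hom (f : M →* G) (hf : Function.Injective f) (j : κ → ι)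
    (hj : Function.Injective j) (h : ∀ x, gen (j x) = f (gen' x))
    (hfull : ∀ x, gen x ∈ f.range → x ∈ Set.range j) (S : Finset M) :
    rk gen (S.image f) = rk gen' S := by
  refine le_antisymm ?_ (rk_le_rk_image_hom f hf j hj h S)
  rw [← cycleRank_image_hom f hf j hj h 1]
  refine cycleRank_mono ?_
  simp only [Finset.subset_iff, Finset.mem_image, Prod.forall, Prod.exists, mem_fullSubgraph_edges]
  rintro _ x ⟨⟨a, ha, rfl⟩, b, hb, hab⟩
  obtain ⟨y, rfl⟩ := hfull x ⟨a⁻¹ * b, by rw [map_mul, map_inv, hab, inv_mul_cancel_left]⟩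
  refine ⟨a, y, ⟨ha, ?_⟩, by simp⟩
  rw [h, ← map_mul] at hab
  rwa [← hf hab]

end Hom

/-! ### The quotients `Xi` and `Psi` as suprema over finite vertex sets -/

section Quotients

open Filter Topology

variable {G : Type*} [Group G] {ι : Type*} {gen : ι → G}

theorem IsConn.neighborhood [Fintype ι] {S : Finset G} (h : IsConn gen S) :
    ∃ T : Finset G, S ⊆ T ∧ IsConn gen T ∧ (∀ g ∈ S, ∀ x, g * gen x ∈ T) ∧
      ∀ g ∈ S, ∀ x, g * (gen x)⁻¹ ∈ T := by
  let N (g : G) : Finset G := {g} ∪ ((Finset.univ.image fun x => g * gen x) ∪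
    Finset.univ.image fun x => g * (gen x)⁻¹)
  have hN : ∀ g, IsConn gen (N g) := by
    intro g
    refine ⟨⟨g, by simp [N]⟩, fun P hP => ?_⟩
    have : ∀ a ∈ N g, P a ↔ P g := by
      intro a ha
      simp only [N, Finset.mem_union, Finset.mem_singleton, Finset.mem_image, Finset.mem_univ,
        true_and] at ha
      rcases ha with rfl | ⟨x, rfl⟩ | ⟨x, rfl⟩
      · rfl
      · exact (hP g (by simp [N]) x (by simp [N])).symm
      · simpa using hP (g * (gen x)⁻¹) (by simp [N]) x (by simp [N])
    intro a ha b hb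
    rw [this a ha, this b hb]
    exact id
  have hI : ∀ I ⊆ S, IsConn gen (S ∪ I.biUnion N) := by
    intro I
    induction I using Finset.induction_on with
    | empty => simpa using h
    | insert a I _ ih =>
      intro hI
      rw [Finset.biUnion_insert, Finset.union_comm (N a), ← Finset.union_assoc]
      refine (ih ((Finset.subset_insert _ _).trans hI)).union (hN a) ⟨a, ?_⟩
      simp [N, hI (Finset.mem_insert_self a I)]
  refine ⟨_, Finset.subset_union_left, hI S subset_rfl, fun g hg x => ?_, fun g hg x => ?_⟩ <;>
  · refine Finset.mem_union_right _ (Finset.mem_biUnion.2 ⟨g, hg, ?_⟩)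
    simp [N]

theorem FinSubgraph.beta2_nonneg (H : FinSubgraph gen) : 0 ≤ H.beta2 := by
  rw [H.beta2_eq]
  exact Nat.cast_nonneg _

theorem FinSubgraph.IsConnected.beta0_pos {H : FinSubgraph gen} (h : H.IsConnected) :
    0 < H.beta0 := by
  obtain ⟨v⟩ := h.nonempty
  exact Finset.card_pos.2 ⟨v, v.2⟩

variable [Fintype ι]

/-- If `S` falls into two parts without edges between them, one part has at least the ratio of the
whole; induct on the size. -/
theorem exists_isConn_le_rk {c : ℝ} {S : Finset G} (hS : S.Nonempty) (h : c * S.card ≤ rk gen S) :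
    ∃ T, IsConn gen T ∧ c * T.card ≤ rk gen T := by
  induction hn : S.card using Nat.strong_induction_on generalizing S with
  | _ n ih =>
    by_cases hc : IsConn gen S
    · exact ⟨S, hc, h⟩
    simp only [IsConn, hS, true_and, not_forall] at hc
    obtain ⟨P, hP, a, ha, b, hb, hPa, hPb⟩ := hc
    have h1 := rk_le_filter_add S P hP
    have h2 := Finset.card_filter_add_card_filter_not (s := S) P
    have ha' : 0 < (S.filter P).card := Finset.card_pos.2 ⟨a, by simp [ha, hPa]⟩
    have hb' : 0 < (S.filter fun g => ¬ P g).card := Finset.card_pos.2 ⟨b, by simp [hb, hPb]⟩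
    by_cases h3 : c * (S.filter P).card ≤ rk gen (S.filter P)
    · exact ih _ (by omega) (Finset.card_pos.1 ha') h3 rfl
    · refine ih _ (by omega) (Finset.card_pos.1 hb') ?_ rfl
      have h1' : (rk gen S : ℝ) ≤ rk gen (S.filter P) + rk gen (S.filter fun g => ¬ P g) := by
        exact_mod_cast h1
      have h2' : ((S.filter P).card : ℝ) + (S.filter fun g => ¬ P g).card = S.card := by
        exact_mod_cast h2
      rw [← h2'] at h
      linarith

/-- Put a translate of a nearly optimal connected set through every point of `A`. The deficit `c |T|
- rk T` is nonnegative and submodular, so the deficit of the union is at most the sum of the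
deficits. -/
theorem exists_isConn_superset {c : ℝ} (hc : ∀ S : Finset G, (rk gen S : ℝ) ≤ c * S.card)
    (hc' : ∀ ε > 0, ∃ S : Finset G, S.Nonempty ∧ (c - ε) * S.card ≤ rk gen S)
    {A : Finset G} (hA : IsConn gen A) {ε : ℝ} (hε : 0 < ε) :
    ∃ U, A ⊆ U ∧ IsConn gen U ∧ (c - ε) * U.card ≤ rk gen U := by
  have hA0 : 0 < (A.card : ℝ) := Nat.cast_pos.2 hA.1.card_pos
  -- The `|A|` deficits then add up to at most `ε |S|`, and `|S|` is at most the size of the union.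
  obtain ⟨S₀, hS₀, h₀⟩ := hc' (ε / A.card) (div_pos hε hA0)
  obtain ⟨S, hS, h⟩ := exists_isConn_le_rk hS₀ h₀
  obtain ⟨s, hs⟩ := hS.1
  let B (a : G) : Finset G := S.image (a * s⁻¹ * ·)
  have hB : ∀ a, a ∈ B a := fun a => Finset.mem_image.2 ⟨s, hs, by simp⟩
  have hBcard : ∀ a, (B a).card = S.card := fun a =>
    Finset.card_image_of_injective _ (mul_right_injective _)
  have key : ∀ I ⊆ A, IsConn gen (A ∪ I.biUnion B) ∧
      c * (I.biUnion B).card - I.card * (ε / A.card * S.card) ≤ rk gen (I.biUnion B) := by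
    intro I
    induction I using Finset.induction_on with
    | empty => exact fun _ => by simpa [rk_empty] using hA
    | insert a I ha ih =>
      intro hI
      obtain ⟨h1, h2⟩ := ih ((Finset.subset_insert _ _).trans hI)
      rw [Finset.biUnion_insert]
      constructor
      · rw [Finset.union_comm (B a), ← Finset.union_assoc]
        refine h1.union (hS.image_mul _) ⟨a, Finset.mem_inter.2 ⟨?_, hB a⟩⟩
        exact Finset.mem_union_left _ (hI (Finset.mem_insert_self a I))
      · have h3 : (rk gen (B a) : ℝ) + rk gen (I.biUnion B) ≤
            rk gen (B a ∪ I.biUnion B) + rk gen (B a ∩ I.biUnion B) := by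
          exact_mod_cast rk_add_le _ _
        have h4 : ((B a ∪ I.biUnion B).card : ℝ) + (B a ∩ I.biUnion B).card =
            (B a).card + (I.biUnion B).card := by
          exact_mod_cast Finset.card_union_add_card_inter _ _
        have h5 := hc (B a ∩ I.biUnion B)
        have h6 : rk gen (B a) = rk gen S := rk_image_mul _ _
        rw [hBcard] at h4
        rw [h6] at h3
        rw [Finset.card_insert_of_notMem ha, Nat.cast_add_one]
        have h7 : ((B a ∪ I.biUnion B).card : ℝ) =
          S.card + (I.biUnion B).card - (B a ∩ I.biUnion B).card := by linarith
        rw [h7]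
        linarith
  obtain ⟨h1, h2⟩ := key A subset_rfl
  have hsub : A ⊆ A.biUnion B := fun a ha => Finset.mem_biUnion.2 ⟨a, ha, hB a⟩
  rw [Finset.union_eq_right.2 hsub] at h1
  refine ⟨A.biUnion B, hsub, h1, le_trans ?_ h2⟩
  obtain ⟨a, ha⟩ := hA.1
  have h3 : (S.card : ℝ) ≤ (A.biUnion B).card := by
    rw [← hBcard a]
    exact_mod_cast Finset.card_le_card (Finset.subset_biUnion_of_mem B ha)
  have h4 : (A.card : ℝ) * (ε / A.card * S.card) = ε * S.card := by field_simp
  rw [h4]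
  nlinarith

theorem xi_le {c : ℝ} (hc : ∀ S : Finset G, S.Nonempty → (rk gen S : ℝ) ≤ c * S.card)
    {H : FinSubgraph gen} (hH : H.IsConnected) : H.xi ≤ c := by
  have h0 := hH.beta0_pos
  rw [FinSubgraph.xi, div_le_iff₀ (Nat.cast_pos.2 h0)]
  exact H.beta2_le.trans (hc _ (Finset.card_pos.1 h0))

theorem limsup_xi_le {c : ℝ} (hc : ∀ S : Finset G, S.Nonempty → (rk gen S : ℝ) ≤ c * S.card)
    {C : ℕ → FinSubgraph gen} (hC : IsExhaustingChain gen C) :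
    limsup (fun i => (C i).xi) atTop ≤ c := by
  refine limsup_le_of_le ?_ (Eventually.of_forall fun i => xi_le hc (hC.connected i))
  exact isCoboundedUnder_le_of_le atTop (x := 0) fun i =>
    div_nonneg (C i).beta2_nonneg (Nat.cast_nonneg _)

theorem Xi_le {c : ℝ} (hc : ∀ S : Finset G, S.Nonempty → (rk gen S : ℝ) ≤ c * S.card) :
    Xi gen ≤ c := by
  refine Real.sSup_le ?_ ?_
  · rintro _ ⟨C, hC, rfl⟩
    exact limsup_xi_le hc hC
  · have := hc {1} (Finset.singleton_nonempty 1)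
    simp only [Finset.card_singleton, Nat.cast_one, mul_one] at this
    exact (Nat.cast_nonneg _).trans this

theorem rk_le_real (S : Finset G) : (rk gen S : ℝ) ≤ Fintype.card ι * S.card := by
  exact_mod_cast rk_le S

/-- Alternate two moves: absorb all neighbours, which forces exhaustion, and enlarge to a connected
set within `1 / (i + 1)` of the optimal ratio. -/
theorem exists_exhaustingChain (hgen : Subgroup.closure (Set.range gen) = ⊤) {c : ℝ}
    (hc : ∀ S : Finset G, (rk gen S : ℝ) ≤ c * S.card)
    (hc' : ∀ ε > 0, ∃ S : Finset G, S.Nonempty ∧ (c - ε) * S.card ≤ rk gen S) :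
    ∃ C : ℕ → FinSubgraph gen, IsExhaustingChain gen C ∧
      Tendsto (fun i => (C i).xi) atTop (𝓝 c) := by
  have step : ∀ (i : ℕ) (S : {S : Finset G // IsConn gen S}), ∃ T : {S : Finset G // IsConn gen S},
      S.1 ⊆ T.1 ∧ (∀ g ∈ S.1, ∀ x, g * gen x ∈ T.1) ∧ (∀ g ∈ S.1, ∀ x, g * (gen x)⁻¹ ∈ T.1) ∧
      (c - 1 / ((i : ℝ) + 1)) * T.1.card ≤ rk gen T.1 := by
    rintro i ⟨S, hS⟩
    obtain ⟨A, h1, h2, h3, h4⟩ := hS.neighborhood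
    obtain ⟨U, h5, h6, h7⟩ := exists_isConn_superset hc hc' h2
      (ε := 1 / ((i : ℝ) + 1)) (by positivity)
    exact ⟨⟨U, h6⟩, h1.trans h5, fun g hg x => h5 (h3 g hg x), fun g hg x => h5 (h4 g hg x), h7⟩
  choose next hn1 hn2 hn3 hn4 using step
  let T : ℕ → {S : Finset G // IsConn gen S} := fun i => Nat.rec ⟨{1}, isConn_singleton 1⟩ next i
  have hT : ∀ i, T (i + 1) = next i (T i) := fun i => rfl
  have hv : ∀ g : G, ∃ i, g ∈ (T i).1 := by
    intro g
    have hg : g ∈ Subgroup.closure (Set.range gen) := hgen ▸ Subgroup.mem_top g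
    induction hg using Subgroup.closure_induction_right with
    | one => exact ⟨0, Finset.mem_singleton_self 1⟩
    | mul_right a _ y hy ih =>
      obtain ⟨x, rfl⟩ := hy
      obtain ⟨i, hi⟩ := ih
      exact ⟨i + 1, hT i ▸ hn2 i _ _ hi x⟩
    | mul_inv_cancel a _ y hy ih =>
      obtain ⟨x, rfl⟩ := hy
      obtain ⟨i, hi⟩ := ih
      exact ⟨i + 1, hT i ▸ hn3 i _ _ hi x⟩
  refine ⟨fun i => fullSubgraph gen (T i).1, ⟨fun i => (T i).2.isConnected, fun i => ?_,
    fun i e he => ?_, hv, fun e => ?_⟩, ?_⟩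
  · exact hT i ▸ hn1 i (T i)
  · obtain ⟨h1, h2⟩ := mem_fullSubgraph_edges.1 he
    have := hT i ▸ hn1 i (T i)
    exact mem_fullSubgraph_edges.2 ⟨this h1, this h2⟩
  · obtain ⟨i, hi⟩ := hv e.1
    exact ⟨i + 1, mem_fullSubgraph_edges.2 ⟨hT i ▸ hn1 i _ hi, hT i ▸ hn2 i _ _ hi e.2⟩⟩
  · rw [← tendsto_add_atTop_iff_nat 1]
    have hlim : Tendsto (fun i : ℕ => c - 1 / ((i : ℝ) + 1)) atTop (𝓝 c) := by
      simpa using (tendsto_const_nhds (x := c)).sub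
        (tendsto_one_div_add_atTop_nhds_zero_nat (𝕜 := ℝ))
    refine tendsto_of_tendsto_of_tendsto_of_le_of_le hlim tendsto_const_nhds (fun i => ?_)
      fun i => xi_le (fun S _ => hc S) (T (i + 1)).2.isConnected
    have h0 : (0 : ℝ) < (fullSubgraph gen (T (i + 1)).1).beta0 :=
      Nat.cast_pos.2 (T (i + 1)).2.isConnected.beta0_pos
    simp only [FinSubgraph.xi]
    rw [le_div_iff₀ h0, beta2_fullSubgraph]
    exact hn4 i (T i)

/-- The supremum of all ratios is the limit along a suitable exhausting chain, hence at most `Xi`.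
Chains can be forgotten afterwards. -/
theorem rk_le_Xi (hgen : Subgroup.closure (Set.range gen) = ⊤) (S : Finset G) :
    (rk gen S : ℝ) ≤ Xi gen * S.card := by
  let Q : Set ℝ := {q | ∃ S : Finset G, S.Nonempty ∧ q = rk gen S / S.card}
  have hpos : ∀ S : Finset G, S.Nonempty → (0 : ℝ) < S.card := fun S hS =>
    Nat.cast_pos.2 hS.card_pos
  have hQ : BddAbove Q := by
    refine ⟨Fintype.card ι, ?_⟩
    rintro _ ⟨S, hS, rfl⟩
    rw [div_le_iff₀ (hpos S hS)]
    exact rk_le_real S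
  have hQ0 : Q.Nonempty := ⟨_, {1}, Finset.singleton_nonempty 1, rfl⟩
  have hc : ∀ S : Finset G, (rk gen S : ℝ) ≤ sSup Q * S.card := by
    intro S
    rcases S.eq_empty_or_nonempty with rfl | hS
    · simp [rk_empty]
    · rw [← div_le_iff₀ (hpos S hS)]
      exact le_csSup hQ ⟨S, hS, rfl⟩
  have hc' : ∀ ε > 0, ∃ S : Finset G, S.Nonempty ∧ (sSup Q - ε) * S.card ≤ rk gen S := by
    intro ε hε
    obtain ⟨_, ⟨S, hS, rfl⟩, h⟩ := exists_lt_of_lt_csSup hQ0 (sub_lt_self (sSup Q) hε)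
    exact ⟨S, hS, ((lt_div_iff₀ (hpos S hS)).1 h).le⟩
  obtain ⟨C, hC, hlim⟩ := exists_exhaustingChain hgen hc hc'
  have : sSup Q ≤ Xi gen := by
    refine le_csSup ⟨sSup Q, ?_⟩ ⟨C, hC, hlim.limsup_eq.symm⟩
    rintro _ ⟨C, hC, rfl⟩
    exact limsup_xi_le (fun S _ => hc S) hC
  exact (hc S).trans (mul_le_mul_of_nonneg_right this (Nat.cast_nonneg _))

theorem Xi_nonneg (hgen : Subgroup.closure (Set.range gen) = ⊤) : 0 ≤ Xi gen := by
  have := rk_le_Xi hgen {1}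
  simp only [Finset.card_singleton, Nat.cast_one, mul_one] at this
  exact (Nat.cast_nonneg _).trans this

theorem exists_Xi_sub_le {ε : ℝ} (hε : 0 < ε) :
    ∃ S : Finset G, S.Nonempty ∧ (Xi gen - ε) * S.card ≤ rk gen S := by
  by_contra! h
  have := Xi_le fun S hS => (h S hS).le
  linarith

theorem Xi_eq_of_finite [Finite G] (hgen : Subgroup.closure (Set.range gen) = ⊤) :
    Xi gen = Fintype.card ι - 1 + 1 / (Nat.card G : ℝ) := by
  have := Fintype.ofFinite G
  rw [Nat.card_eq_fintype_card]
  have hpos : (0 : ℝ) < Fintype.card G := Nat.cast_pos.2 Fintype.card_pos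
  have h1 : (rk gen Finset.univ : ℝ) + Fintype.card G = Fintype.card G * Fintype.card ι + 1 := by
    exact_mod_cast rk_univ_add_card hgen
  refine le_antisymm ?_ ?_
  -- A nearly optimal set can be chosen to contain the whole group, so the whole group is optimal.
  · refine le_of_forall_sub_le fun ε hε => ?_
    obtain ⟨U, h2, -, h3⟩ := exists_isConn_superset (rk_le_Xi hgen) (fun ε => exists_Xi_sub_le)
      (isConn_univ hgen) hε
    rw [Finset.univ_subset_iff.1 h2, Finset.card_univ] at h3
    rw [← mul_le_mul_iff_of_pos_right hpos]
    refine h3.trans (le_of_eq ?_)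
    field_simp
    linarith
  · have h2 := rk_le_Xi hgen Finset.univ
    rw [Finset.card_univ] at h2
    have : (Fintype.card ι - 1 + 1 / (Fintype.card G : ℝ)) * Fintype.card G =
      rk gen Finset.univ := by
      field_simp
      linarith
    rw [← this] at h2
    exact le_of_mul_le_mul_right h2 hpos

theorem psi_le {p : ℝ} (hp : ∀ S : Finset G, 1 < S.card → (rk gen S : ℝ) ≤ p * (S.card - 1))
    {H : FinSubgraph gen} (hH : 1 < H.beta0) : H.psi ≤ p := by
  have : (1 : ℝ) < H.beta0 := by exact_mod_cast hH
  rw [FinSubgraph.psi, div_le_iff₀ (by linarith)]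
  exact H.beta2_le.trans (hp _ hH)

theorem rk_le_Psi {S : Finset G} (hS : 1 < S.card) :
    (rk gen S : ℝ) ≤ Psi gen * (S.card - 1) := by
  have h1 : (1 : ℝ) < S.card := by exact_mod_cast hS
  rw [← div_le_iff₀ (by linarith)]
  refine le_csSup ⟨2 * Fintype.card ι, ?_⟩ ⟨fullSubgraph gen S, hS, ?_⟩
  · rintro _ ⟨H, hH, rfl⟩
    refine psi_le (fun S hS => (rk_le_real S).trans ?_) hH
    have : (2 : ℝ) ≤ S.card := by exact_mod_cast hS
    have h0 : (0 : ℝ) ≤ Fintype.card ι := Nat.cast_nonneg _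
    nlinarith
  · rw [FinSubgraph.psi, beta2_fullSubgraph]
    rfl

/-- Singletons, not covered by `Psi`, carry no loops when the presentation is reduced. -/
theorem rk_le_Psi_of_isReduced (hred : IsReduced gen) {S : Finset G} (hS : S.Nonempty) :
    (rk gen S : ℝ) ≤ Psi gen * (S.card - 1) := by
  rcases (Nat.succ_le_of_lt hS.card_pos).eq_or_lt with h | h
  · obtain ⟨g, rfl⟩ := Finset.card_eq_one.1 h.symm
    simp [rk_singleton hred]
  · exact rk_le_Psi h

theorem exists_one_lt_card (V : Type*) [Nontrivial V] : ∃ S : Finset V, 1 < S.card := by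
  obtain ⟨a, b, hab⟩ := exists_pair_ne V
  exact ⟨{a, b}, by rw [Finset.card_pair hab]; norm_num⟩

theorem Psi_le [Nontrivial G] {p : ℝ}
    (hp : ∀ S : Finset G, 1 < S.card → (rk gen S : ℝ) ≤ p * (S.card - 1)) : Psi gen ≤ p := by
  obtain ⟨S, hS⟩ := exists_one_lt_card G
  refine csSup_le ⟨_, fullSubgraph gen S, hS, rfl⟩ ?_
  rintro _ ⟨H, hH, rfl⟩
  exact psi_le hp hH

theorem Psi_nonneg [Nontrivial G] : 0 ≤ Psi gen := by
  obtain ⟨S, hS⟩ := exists_one_lt_card G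
  have h1 : (1 : ℝ) < S.card := by exact_mod_cast hS
  have := (Nat.cast_nonneg (rk gen S)).trans (rk_le_Psi (gen := gen) hS)
  exact nonneg_of_mul_nonneg_left this (by linarith)

end Quotients

/-! ### The profile and its maximizers -/

section Profile

variable {G : Type*} [Group G] {ι : Type*} [Fintype ι] {gen : ι → G} {t : ℝ}

/-- The supremum of `(β₂(S) + t) / β₀(S)` over the nonempty finite full subgraphs. -/
def profile (gen : ι → G) (t : ℝ) : ℝ :=
  sSup {q : ℝ | ∃ S : Finset G, S.Nonempty ∧ q = (rk gen S + t) / S.card}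

theorem rk_add_le_profile (ht : 0 ≤ t) {S : Finset G} (hS : S.Nonempty) :
    rk gen S + t ≤ profile gen t * S.card := by
  have hpos : ∀ S : Finset G, S.Nonempty → (1 : ℝ) ≤ S.card := fun S hS =>
    Nat.one_le_cast.2 hS.card_pos
  have h1 := hpos S hS
  rw [← div_le_iff₀ (by linarith)]
  refine le_csSup ⟨Fintype.card ι + t, ?_⟩ ⟨S, hS, rfl⟩
  rintro _ ⟨T, hT, rfl⟩
  have h2 := hpos T hT
  have h3 := rk_le_real (gen := gen) T
  rw [div_le_iff₀ (by linarith)]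
  nlinarith

theorem exists_profile_sub_le {ε : ℝ} (hε : 0 < ε) :
    ∃ S : Finset G, S.Nonempty ∧ (profile gen t - ε) * S.card ≤ rk gen S + t := by
  obtain ⟨_, ⟨S, hS, rfl⟩, h⟩ := exists_lt_of_lt_csSup
    (⟨_, {1}, Finset.singleton_nonempty 1, rfl⟩ :
      {q : ℝ | ∃ S : Finset G, S.Nonempty ∧ q = (rk gen S + t) / S.card}.Nonempty)
    (sub_lt_self (profile gen t) hε)
  exact ⟨S, hS, ((lt_div_iff₀ (Nat.cast_pos.2 hS.card_pos)).1 h).le⟩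

theorem profile_le {c : ℝ} (hc : ∀ S : Finset G, S.Nonempty → rk gen S + t ≤ c * S.card) :
    profile gen t ≤ c := by
  refine csSup_le ⟨_, {1}, Finset.singleton_nonempty 1, rfl⟩ ?_
  rintro _ ⟨S, hS, rfl⟩
  rw [div_le_iff₀ (Nat.cast_pos.2 hS.card_pos)]
  exact hc S hS

theorem Xi_le_profile (ht : 0 ≤ t) : Xi gen ≤ profile gen t :=
  Xi_le fun S hS => by linarith [rk_add_le_profile (gen := gen) ht hS]

theorem profile_mono {u : ℝ} (ht : 0 ≤ t) (htu : t ≤ u) : profile gen t ≤ profile gen u :=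
  profile_le fun S hS => by linarith [rk_add_le_profile (gen := gen) (ht.trans htu) hS]

theorem profile_Psi_le (hred : IsReduced gen) : profile gen (Psi gen) ≤ Psi gen :=
  profile_le fun S hS => by linarith [rk_le_Psi_of_isReduced hred hS]

theorem exists_Psi_sub_le [Nontrivial G] {ε : ℝ} (hε : 0 < ε) :
    ∃ S : Finset G, 1 < S.card ∧ (Psi gen - ε) * (S.card - 1) ≤ rk gen S := by
  by_contra! h
  have := Psi_le fun S hS => (h S hS).le
  linarith

theorem profile_eq_Xi (hred : IsReduced gen) (hΨ : Psi gen = Xi gen) (ht : 0 ≤ t)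
    (htΨ : t ≤ Psi gen) : profile gen t = Xi gen :=
  le_antisymm ((profile_mono ht htΨ).trans ((profile_Psi_le hred).trans hΨ.le)) (Xi_le_profile ht)

/-- Since `rk S ≤ Xi |S|`, sets with ratio at least the midpoint of `Xi` and `F` have bounded size.
Their ratios take finitely many values, so the supremum is attained. -/
theorem exists_rk_add_eq (hgen : Subgroup.closure (Set.range gen) = ⊤) {F : ℝ} (hF : Xi gen < F)
    (p : Finset G → Prop) (hp : ∀ S, p S → S.Nonempty) (h : ∀ S, p S → rk gen S + t ≤ F * S.card)
    (h' : ∀ ε > 0, ∃ S, p S ∧ (F - ε) * S.card ≤ rk gen S + t) :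
    ∃ S, p S ∧ rk gen S + t = F * S.card := by
  obtain ⟨N, hN⟩ := exists_nat_ge (2 * t / (F - Xi gen))
  rw [div_le_iff₀ (by linarith)] at hN
  have hbd : ∀ S : Finset G, (F - (F - Xi gen) / 2) * S.card ≤ rk gen S + t → S.card ≤ N := by
    intro S hS
    have h1 := rk_le_Xi hgen S
    have h2 : (S.card : ℝ) * (F - Xi gen) ≤ N * (F - Xi gen) := by linarith
    exact_mod_cast le_of_mul_le_mul_right h2 (by linarith)
  let V : Set ℝ := {q | ∃ S, p S ∧ q = (rk gen S + t) / S.card ∧ F - (F - Xi gen) / 2 ≤ q}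
  have hpos : ∀ S, p S → (0 : ℝ) < S.card := fun S hS => Nat.cast_pos.2 (hp S hS).card_pos
  have hV : V.Finite := by
    refine (((Finset.range (Fintype.card ι * N + 1) ×ˢ Finset.range (N + 1)).image
      fun x : ℕ × ℕ => ((x.1 : ℝ) + t) / x.2).finite_toSet).subset ?_
    rintro _ ⟨S, hS, rfl, hq⟩
    rw [le_div_iff₀ (hpos S hS)] at hq
    have h1 := hbd S hq
    refine Finset.mem_coe.2 (Finset.mem_image.2 ⟨(rk gen S, S.card), ?_, rfl⟩)
    rw [Finset.mem_product, Finset.mem_range, Finset.mem_range]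
    exact ⟨Nat.lt_succ_of_le ((rk_le S).trans (Nat.mul_le_mul_left _ h1)), Nat.lt_succ_of_le h1⟩
  have hmem : ∀ ε > 0, ε ≤ (F - Xi gen) / 2 → ∃ q ∈ V, F - ε ≤ q := by
    intro ε hε hε'
    obtain ⟨S, hS, hle⟩ := h' ε hε
    rw [← le_div_iff₀ (hpos S hS)] at hle
    exact ⟨_, ⟨S, hS, rfl, by linarith⟩, hle⟩
  have hne : V.Nonempty := by
    obtain ⟨q, hq, -⟩ := hmem _ (by linarith) le_rfl
    exact ⟨q, hq⟩
  obtain ⟨S, hS, hq, -⟩ := hne.csSup_mem hV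
  refine ⟨S, hS, le_antisymm (h S hS) ?_⟩
  rw [← le_div_iff₀ (hpos S hS), ← hq]
  refine le_of_forall_sub_le fun ε hε => ?_
  obtain ⟨q, hq, hle⟩ := hmem (min ε ((F - Xi gen) / 2)) (lt_min hε (by linarith))
    (min_le_right _ _)
  have := le_csSup hV.bddAbove hq
  have := min_le_left ε ((F - Xi gen) / 2)
  linarith

/-- Above the cyclomatic quotient, the supremum defining `profile` is attained by a finite subgroup
generated by a subset of the generators; it contains every set that attains the supremum and meets
the subgroup. -/
theorem exists_subgroup_rk_add_eq (hgen : Subgroup.closure (Set.range gen) = ⊤) (ht : 0 ≤ t)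
    (hF : Xi gen < profile gen t) :
    ∃ (Y : Finset ι) (S : Finset G), (∀ g, g ∈ S ↔ g ∈ Gp gen Y) ∧
      (∀ x, gen x ∈ Gp gen Y → x ∈ Y) ∧ rk gen S + t = profile gen t * S.card ∧
      ∀ T : Finset G, rk gen T + t = profile gen t * T.card →
        T.card ≤ S.card ∧ ((T ∩ S).Nonempty → T ⊆ S) := by
  set F := profile gen t
  have hle : ∀ S : Finset G, S.Nonempty → rk gen S + t ≤ F * S.card := fun S =>
    rk_add_le_profile ht
  obtain ⟨S₀, hS₀, h₀⟩ := exists_rk_add_eq hgen hF Finset.Nonempty (fun S hS => hS) hle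
    fun ε => exists_profile_sub_le
  have hpos : 0 < t := by
    have h1 := rk_le_Xi hgen S₀
    have h2 : (0 : ℝ) < S₀.card := Nat.cast_pos.2 hS₀.card_pos
    nlinarith
  have hF0 : Xi gen < F := hF
  obtain ⟨N, hN⟩ := exists_nat_ge (t / (F - Xi gen))
  rw [div_le_iff₀ (by linarith)] at hN
  have hbd : ∀ S : Finset G, rk gen S + t = F * S.card → S.card ≤ N := by
    intro S hS
    have h1 := rk_le_Xi hgen S
    have h2 : (S.card : ℝ) * (F - Xi gen) ≤ N * (F - Xi gen) := by linarith
    exact_mod_cast le_of_mul_le_mul_right h2 (by linarith)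
  have hnonempty : ∀ S : Finset G, rk gen S + t = F * S.card → S.Nonempty := by
    intro S hS
    by_contra h
    rw [Finset.not_nonempty_iff_eq_empty] at h
    simp [h, rk_empty] at hS
    linarith
  -- Supermodularity gives the union at least what the two maximizers have together minus what the
  -- intersection can have at most.
  have hunion : ∀ A B : Finset G, rk gen A + t = F * A.card → rk gen B + t = F * B.card →
      (A ∩ B).Nonempty → rk gen (A ∪ B) + t = F * (A ∪ B).card := by
    intro A B hA hB hAB
    refine le_antisymm (hle _ ((hnonempty A hA).mono Finset.subset_union_left)) ?_
    have h1 := hle _ hAB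
    have h2 : (rk gen A : ℝ) + rk gen B ≤ rk gen (A ∪ B) + rk gen (A ∩ B) := by
      exact_mod_cast rk_add_le A B
    have h3 : ((A ∪ B).card : ℝ) + (A ∩ B).card = A.card + B.card := by
      exact_mod_cast Finset.card_union_add_card_inter A B
    have h4 : ((A ∪ B).card : ℝ) = A.card + B.card - (A ∩ B).card := by linarith
    rw [h4]
    linarith
  obtain ⟨S₁, h₁, hmax₁⟩ : ∃ S : Finset G, rk gen S + t = F * S.card ∧
      ∀ T : Finset G, rk gen T + t = F * T.card → T.card ≤ S.card := by
    have hP : ∃ n, ∃ S : Finset G, rk gen S + t = F * S.card ∧ S.card = n := ⟨_, S₀, h₀, rfl⟩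
    have hsp := Nat.findGreatest_spec (P := fun n => ∃ S : Finset G,
      rk gen S + t = F * S.card ∧ S.card = n) (hbd S₀ h₀) ⟨S₀, h₀, rfl⟩
    obtain ⟨S, hS, hcard⟩ := hsp
    exact ⟨S, hS, fun T hT => hcard ▸ Nat.le_findGreatest (hbd T hT) ⟨T, hT, rfl⟩⟩
  obtain ⟨a, ha⟩ := hnonempty S₁ h₁
  have htrans : ∀ (g : G) (S : Finset G), rk gen S + t = F * S.card →
      rk gen (S.image (g * ·)) + t = F * (S.image (g * ·)).card := by
    intro g S hS
    rw [rk_image_mul, Finset.card_image_of_injective _ (mul_right_injective g), hS]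
  obtain ⟨S, hS, hmax, hone⟩ : ∃ S : Finset G, rk gen S + t = F * S.card ∧
      (∀ T : Finset G, rk gen T + t = F * T.card → T.card ≤ S.card) ∧ 1 ∈ S := by
    refine ⟨S₁.image (a⁻¹ * ·), htrans _ _ h₁, ?_, Finset.mem_image.2 ⟨a, ha, by simp⟩⟩
    rwa [Finset.card_image_of_injective _ (mul_right_injective _)]
  have habs : ∀ T : Finset G, rk gen T + t = F * T.card → (T ∩ S).Nonempty → T ⊆ S := by
    intro T hT hTS
    have := hmax _ (hunion T S hT hS hTS)
    have h2 := Finset.eq_of_subset_of_card_le (Finset.subset_union_right (s₁ := T)) this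
    rw [h2]
    exact Finset.subset_union_left
  -- The translate of `S` by `a⁻¹` is a maximizer meeting `S` in `1`, hence is absorbed by `S`.
  have hdiv : ∀ a ∈ S, ∀ b ∈ S, a⁻¹ * b ∈ S := by
    intro a ha b hb
    refine habs _ (htrans a⁻¹ S hS) ⟨1, ?_⟩ (Finset.mem_image_of_mem _ hb)
    exact Finset.mem_inter.2 ⟨Finset.mem_image.2 ⟨a, ha, by simp⟩, hone⟩
  have hinv : ∀ a ∈ S, a⁻¹ ∈ S := fun a ha => by simpa using hdiv a ha 1 hone
  let K : Subgroup G :=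
    { carrier := S
      one_mem' := hone
      mul_mem' := fun {a b} ha hb => by simpa using hdiv a⁻¹ (hinv a ha) b hb
      inv_mem' := fun {a} ha => hinv a ha }
  have hK : ∀ g, g ∈ K ↔ g ∈ S := fun g => Iff.rfl
  let Y : Finset ι := Finset.univ.filter fun x => gen x ∈ K
  have hYK : Gp gen Y ≤ K := by
    rw [Gp, Subgroup.closure_le]
    rintro _ ⟨x, hx, rfl⟩
    exact (Finset.mem_filter.1 hx).2
  have hfull : ∀ x, gen x ∈ Gp gen Y → x ∈ Y := fun x hx =>
    Finset.mem_filter.2 ⟨Finset.mem_univ _, hYK hx⟩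
  refine ⟨Y, S, fun g => ⟨fun hg => ?_, fun hg => hYK hg⟩, hfull, hS,
    fun T hT => ⟨hmax T hT, habs T hT⟩⟩
  -- Otherwise `Gp gen Y` separates `S` into two nonempty parts with no edges between them. Adding
  -- their two bounds gives `rk S + 2t ≤ F |S|`, impossible as `t > 0`.
  by_contra hgY
  have h1 := rk_le_filter_add (gen := gen) S (· ∈ Gp gen Y) fun g hg x hgx => by
    have hx : gen x ∈ K := by simpa using K.mul_mem (K.inv_mem hg) hgx
    have hx' : gen x ∈ Gp gen Y := Subgroup.subset_closure
      (Set.mem_image_of_mem _ (Finset.mem_coe.2 (Finset.mem_filter.2 ⟨Finset.mem_univ _, hx⟩)))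
    exact (Subgroup.mul_mem_cancel_right _ hx').symm
  have h2 := Finset.card_filter_add_card_filter_not (s := S) (· ∈ Gp gen Y)
  have h3 := hle (S.filter (· ∈ Gp gen Y)) ⟨1, by simp [hone]⟩
  have h4 := hle (S.filter fun g => ¬ g ∈ Gp gen Y) ⟨g, by simp [hg, hgY]⟩
  have h1' : (rk gen S : ℝ) ≤ rk gen (S.filter (· ∈ Gp gen Y)) +
    rk gen (S.filter fun g => ¬ g ∈ Gp gen Y) := by exact_mod_cast h1
  have h2' : ((S.filter (· ∈ Gp gen Y)).card : ℝ) + (S.filter fun g => ¬ g ∈ Gp gen Y).card =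
    S.card := by exact_mod_cast h2
  rw [← h2'] at hS
  linarith

end Profile

/-! ### Subgroups generated by subsets of the generators -/

section SubGen

variable {G : Type*} [Group G] {ι : Type*} {gen : ι → G}

theorem closure_range_subGen (Y : Finset ι) :
    Subgroup.closure (Set.range (subGen gen Y)) = ⊤ := by
  have h := Subgroup.closure_closure_coe_preimage (k := gen '' (Y : Set ι))
  refine Eq.trans (congrArg _ ?_) h
  ext ⟨g, hg⟩
  constructor
  · rintro ⟨y, hy⟩
    exact ⟨y.1, y.2, congrArg Subtype.val hy⟩
  · rintro ⟨y, hy, rfl⟩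
    exact ⟨⟨y, hy⟩, rfl⟩

variable {Y : Finset ι} {S : Finset G}

theorem natCard_Gp (hS : ∀ g, g ∈ S ↔ g ∈ Gp gen Y) : Nat.card (Gp gen Y) = S.card := by
  rw [← Nat.card_congr (Equiv.subtypeEquivRight hS)]
  exact Nat.card_eq_card_toFinset (S : Set G) |>.trans (by simp)

theorem finite_Gp (hS : ∀ g, g ∈ S ↔ g ∈ Gp gen Y) : Finite (Gp gen Y) :=
  Finite.of_equiv S (Equiv.subtypeEquivRight hS)

theorem exists_finset_Gp (Y : Finset ι) [Finite (Gp gen Y)] :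
    ∃ S : Finset G, ∀ g, g ∈ S ↔ g ∈ Gp gen Y :=
  ⟨(Set.toFinite (Gp gen Y : Set G)).toFinset, by simp⟩

theorem Xi_subGen (hS : ∀ g, g ∈ S ↔ g ∈ Gp gen Y) :
    Xi (subGen gen Y) = Y.card - 1 + 1 / (S.card : ℝ) := by
  have := finite_Gp hS
  rw [Xi_eq_of_finite (closure_range_subGen Y), natCard_Gp hS, Fintype.card_coe]

theorem rk_subGen_univ (hS : ∀ g, g ∈ S ↔ g ∈ Gp gen Y) [Fintype (Gp gen Y)] :
    (rk (subGen gen Y) Finset.univ : ℝ) = (Y.card - 1) * S.card + 1 := by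
  have h := rk_univ_add_card (closure_range_subGen (gen := gen) Y)
  rw [← Nat.card_eq_fintype_card, natCard_Gp hS, Fintype.card_coe] at h
  have : (rk (subGen gen Y) Finset.univ : ℝ) + S.card = S.card * Y.card + 1 := by exact_mod_cast h
  linarith

theorem image_subtype_univ (hS : ∀ g, g ∈ S ↔ g ∈ Gp gen Y) [Fintype (Gp gen Y)] :
    (Finset.univ : Finset (Gp gen Y)).image (Gp gen Y).subtype = S := by
  ext g
  simp [hS]

theorem nontrivial_Gp (hS : ∀ g, g ∈ S ↔ g ∈ Gp gen Y) (h : 1 < S.card) :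
    Nontrivial (Gp gen Y) := by
  have := finite_Gp hS
  rw [← Finite.one_lt_card_iff_nontrivial, natCard_Gp hS]
  exact h

/-- Under minimality each new generator strictly enlarges the subgroup, since otherwise it could be
dropped from the whole generating set. -/
theorem card_lt_card_Gp (hgen : Subgroup.closure (Set.range gen) = ⊤) (hmin : IsMinimal gen)
    (Y : Finset ι) (hfin : Finite (Gp gen Y)) : Y.card < Nat.card (Gp gen Y) := by
  induction Y using Finset.induction_on with
  | empty => exact Finite.card_pos
  | insert a Y ha ih =>
    have hle : Gp gen Y ≤ Gp gen (insert a Y) :=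
      Subgroup.closure_mono (Set.image_mono (by simp))
    have hfin' : Finite (Gp gen Y) := Finite.of_injective _ (Subgroup.inclusion_injective hle)
    have hlt : Gp gen Y < Gp gen (insert a Y) := by
      refine lt_of_le_of_ne hle fun heq => ?_
      refine hmin {a}ᶜ (fun h => ?_) ?_
      · have := h.symm ▸ Set.mem_univ a
        simp at this
      · rw [eq_top_iff, ← hgen, Subgroup.closure_le]
        rintro _ ⟨x, rfl⟩
        by_cases hx : x = a
        · have h1 : gen x ∈ Gp gen Y :=
            heq ▸ Subgroup.subset_closure ⟨x, by simp [hx], rfl⟩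
          refine Subgroup.closure_mono (Set.image_mono ?_) h1
          rintro y hy rfl
          exact ha hy
        · exact Subgroup.subset_closure ⟨x, hx, rfl⟩
    rw [Finset.card_insert_of_notMem ha]
    refine lt_of_le_of_lt (Nat.succ_le_of_lt (ih hfin')) ?_
    exact Set.Finite.card_lt_card (s := (Gp gen Y : Set G)) (t := Gp gen (insert a Y))
      (Set.toFinite _) hlt

variable [Fintype ι]

/-- Only an inequality, because generators outside `Y` may lie in `Gp gen Y` and give further edges.
-/
theorem le_rk_Gp (hS : ∀ g, g ∈ S ↔ g ∈ Gp gen Y) :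
    ((Y.card - 1) * S.card + 1 : ℝ) ≤ rk gen S := by
  have := finite_Gp hS
  have := Fintype.ofFinite (Gp gen Y)
  rw [← rk_subGen_univ hS, Nat.cast_le, ← image_subtype_univ hS]
  exact rk_le_rk_image_hom (gen' := subGen gen Y) (Gp gen Y).subtype Subtype.val_injective Subtype.val Subtype.val_injective
    (fun _ => rfl) _

theorem rk_image_subtype (hfull : ∀ x, gen x ∈ Gp gen Y → x ∈ Y) (T : Finset (Gp gen Y)) :
    rk gen (T.image (Gp gen Y).subtype) = rk (subGen gen Y) T :=
  rk_image_hom (gen' := subGen gen Y) (Gp gen Y).subtype Subtype.val_injective Subtype.val Subtype.val_injective (fun _ => rfl)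
    (fun x hx => ⟨⟨x, hfull x (by simpa using hx)⟩, rfl⟩) T

theorem rk_Gp (hS : ∀ g, g ∈ S ↔ g ∈ Gp gen Y) (hfull : ∀ x, gen x ∈ Gp gen Y → x ∈ Y) :
    (rk gen S : ℝ) = (Y.card - 1) * S.card + 1 := by
  have := finite_Gp hS
  have := Fintype.ofFinite (Gp gen Y)
  rw [← rk_subGen_univ hS, ← rk_image_subtype hfull, image_subtype_univ hS]

theorem Psi_subGen_le [Nontrivial (Gp gen Y)] : Psi (subGen gen Y) ≤ Psi gen := by
  refine Psi_le fun T hT => ?_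
  have hcard : (T.image (Gp gen Y).subtype).card = T.card :=
    Finset.card_image_of_injective _ Subtype.val_injective
  have h1 := rk_le_Psi (gen := gen) (S := T.image (Gp gen Y).subtype) (by rwa [hcard])
  rw [hcard] at h1
  refine le_trans (Nat.cast_le.2 ?_) h1
  exact rk_le_rk_image_hom (gen' := subGen gen Y) (Gp gen Y).subtype Subtype.val_injective Subtype.val Subtype.val_injective
    (fun _ => rfl) _

theorem Psi_subGen_eq {Y : Finset ι} (hfull : ∀ x, gen x ∈ Gp gen Y → x ∈ Y)
    {T : Finset G} (hT : ∀ g ∈ T, g ∈ Gp gen Y) (hcard : 1 < T.card)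
    (h : (rk gen T : ℝ) = Psi gen * (T.card - 1)) : Psi gen = Psi (subGen gen Y) := by
  obtain ⟨T, rfl⟩ : ∃ T' : Finset (Gp gen Y), T'.image (Gp gen Y).subtype = T := by
    refine ⟨T.attach.image fun g => ⟨g.1, hT g.1 g.2⟩, ?_⟩
    ext g
    simpa using hT g
  have hc : (T.image (Gp gen Y).subtype).card = T.card :=
    Finset.card_image_of_injective _ Subtype.val_injective
  rw [hc] at h hcard
  have : Nontrivial (Gp gen Y) := by
    obtain ⟨a, -, b, -, hab⟩ := Finset.one_lt_card.1 hcard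
    exact ⟨a, b, hab⟩
  refine le_antisymm ?_ Psi_subGen_le
  have h1 := rk_le_Psi (gen := subGen gen Y) hcard
  rw [← rk_image_subtype hfull, h] at h1
  have : (1 : ℝ) < T.card := by exact_mod_cast hcard
  exact le_of_mul_le_mul_right h1 (by linarith)

end SubGen

/-! ### Evaluating the profile by finite subgroups -/

section Extremal

variable {G : Type*} [Group G] [Nontrivial G] {ι : Type*} [Fintype ι] {gen : ι → G} {t : ℝ}

/-- If `Ψ > Ξ` then `Ψ` is attained by a finite subgroup generated by a set of generators. -/
theorem exists_subgroup_rk_eq_Psi (hgen : Subgroup.closure (Set.range gen) = ⊤)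
    (hred : IsReduced gen) (hΨ : Xi gen < Psi gen) :
    ∃ (Y : Finset ι) (S : Finset G), (∀ g, g ∈ S ↔ g ∈ Gp gen Y) ∧
      (∀ x, gen x ∈ Gp gen Y → x ∈ Y) ∧ (rk gen S : ℝ) = Psi gen * (S.card - 1) ∧
      1 < S.card := by
  have h0 : 0 ≤ Psi gen := Psi_nonneg
  obtain ⟨T, hT, hTeq⟩ := exists_rk_add_eq (t := Psi gen) hgen hΨ (fun S => 1 < S.card)
    (fun S hS => Finset.card_pos.1 (by omega)) (fun S hS => by linarith [rk_le_Psi (gen := gen) hS])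
    fun ε hε => by
      obtain ⟨S, hS, h⟩ := exists_Psi_sub_le (gen := gen) hε
      exact ⟨S, hS, by linarith⟩
  -- A set attaining `Psi` is the same as a set of at least two vertices attaining the profile at `t
  -- = Psi`.
  have hprof : profile gen (Psi gen) = Psi gen := by
    refine le_antisymm (profile_Psi_le hred) ?_
    have h1 := rk_add_le_profile (gen := gen) h0 (Finset.card_pos.1 (by omega : 0 < T.card))
    rw [hTeq] at h1
    exact le_of_mul_le_mul_right h1 (Nat.cast_pos.2 (by omega))
  obtain ⟨Y, S, hS, hfull, heq, hmax⟩ := exists_subgroup_rk_add_eq hgen h0 (hprof.symm ▸ hΨ)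
  rw [hprof] at heq hmax
  exact ⟨Y, S, hS, hfull, by linarith, lt_of_lt_of_le hT (hmax T hTeq).1⟩

/-- If the profile equals `Xi`, a subgroup attaining `Psi` serves. Otherwise the subgroup maximizing
the profile serves: it contains one attaining `Psi`, so it has the same `Psi`. -/
theorem exists_profile_eq (hgen : Subgroup.closure (Set.range gen) = ⊤)
    (hred : IsReduced gen) (hΨ : Xi gen < Psi gen) (ht : 0 ≤ t) (htΨ : t ≤ Psi gen) :
    ∃ Y : Finset ι, Finite (Gp gen Y) ∧ Nontrivial (Gp gen Y) ∧ Psi gen = Psi (subGen gen Y) ∧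
      profile gen t = max (Xi gen) (Xi (subGen gen Y) + t / (Nat.card (Gp gen Y) : ℝ)) := by
  obtain ⟨Y', S', hS', hfull', heq', hcard'⟩ := exists_subgroup_rk_eq_Psi hgen hred hΨ
  have hval : ∀ {Y : Finset ι} {S : Finset G}, (∀ g, g ∈ S ↔ g ∈ Gp gen Y) →
      (∀ x, gen x ∈ Gp gen Y → x ∈ Y) → 1 < S.card →
      (Xi (subGen gen Y) + t / (Nat.card (Gp gen Y) : ℝ)) * S.card = rk gen S + t := by
    intro Y S hS hfull hcard
    have : (S.card : ℝ) ≠ 0 := Nat.cast_ne_zero.2 (by omega)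
    rw [Xi_subGen hS, natCard_Gp hS, rk_Gp hS hfull]
    field_simp
  rcases (Xi_le_profile (gen := gen) ht).eq_or_lt with hX | hX
  · refine ⟨Y', finite_Gp hS', nontrivial_Gp hS' hcard',
      Psi_subGen_eq hfull' (fun g => (hS' g).1) hcard' heq', ?_⟩
    rw [max_eq_left, hX]
    rw [hX]
    have h1 := rk_add_le_profile (gen := gen) ht (Finset.card_pos.1 (by omega : 0 < S'.card))
    rw [← hval hS' hfull' hcard'] at h1
    exact le_of_mul_le_mul_right h1 (Nat.cast_pos.2 (by omega))
  · obtain ⟨Y, S, hS, hfull, heq, hmax⟩ := exists_subgroup_rk_add_eq hgen ht hX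
    have hle : profile gen t ≤ Psi gen := (profile_mono ht htΨ).trans (profile_Psi_le hred)
    -- Passing from `S` to `S' ∪ S` gains at least `Psi` in rank per new vertex, and `Psi` is at
    -- least the profile. So the union is a maximizer, and `S` was a largest one.
    have hsub : S' ⊆ S := by
      have hne : (S' ∩ S).Nonempty := ⟨1, Finset.mem_inter.2
        ⟨(hS' 1).2 (one_mem _), (hS 1).2 (one_mem _)⟩⟩
      have h1 := rk_le_Psi_of_isReduced hred hne
      have h2 : (rk gen S' : ℝ) + rk gen S ≤ rk gen (S' ∪ S) + rk gen (S' ∩ S) := by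
        exact_mod_cast rk_add_le S' S
      have h3 : ((S' ∪ S).card : ℝ) + (S' ∩ S).card = S'.card + S.card := by
        exact_mod_cast Finset.card_union_add_card_inter S' S
      have h4 : ((S' ∪ S).card : ℝ) = S'.card + S.card - (S' ∩ S).card := by linarith
      have h5 : ((S' ∩ S).card : ℝ) ≤ S'.card := by
        exact_mod_cast Finset.card_le_card Finset.inter_subset_left
      have h6 : rk gen (S' ∪ S) + t = profile gen t * (S' ∪ S).card := by
        refine le_antisymm (rk_add_le_profile ht (hne.mono
          (Finset.inter_subset_left.trans Finset.subset_union_left))) ?_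
        rw [h4]
        nlinarith
      have h7 := Finset.eq_of_subset_of_card_le (Finset.subset_union_right (s₁ := S'))
        (hmax _ h6).1
      rw [h7]
      exact Finset.subset_union_left
    have hcard : 1 < S.card := hcard'.trans_le (Finset.card_le_card hsub)
    refine ⟨Y, finite_Gp hS, nontrivial_Gp hS hcard,
      Psi_subGen_eq hfull (fun g hg => (hS g).1 (hsub hg)) hcard' heq', ?_⟩
    have h0 : (0 : ℝ) < S.card := Nat.cast_pos.2 (by omega)
    have h8 : Xi (subGen gen Y) + t / (Nat.card (Gp gen Y) : ℝ) = profile gen t := by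
      refine mul_right_cancel₀ h0.ne' ?_
      rw [hval hS hfull hcard, heq]
    rw [h8, max_eq_right hX.le]

theorem profile_eq_of_isExtremal (hgen : Subgroup.closure (Set.range gen) = ⊤)
    (hred : IsReduced gen) (ht : 0 ≤ t) (htΨ : t ≤ Psi gen)
    {Y : Finset ι} (hY : IsExtremal gen Y)
    (hΨY : Psi gen = (Y.card : ℝ) - 1 + (Y.card : ℝ) / ((Nat.card (Gp gen Y) : ℝ) - 1)) :
    profile gen t = max (Xi gen) (Xi (subGen gen Y) + t / (Nat.card (Gp gen Y) : ℝ)) := by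
  obtain ⟨hfin, hmaxY, hminY⟩ := hY
  obtain ⟨S, hS⟩ := exists_finset_Gp (gen := gen) Y
  rw [natCard_Gp hS] at hΨY hminY ⊢
  rw [Xi_subGen hS]
  have hone : 1 ∈ S := (hS 1).2 (one_mem _)
  -- For a trivial subgroup, reducedness forces `Y = ∅`, and with `0 / 0 = 0` the formula would read
  -- `Psi = -1`.
  have hm : 1 < S.card := by
    by_contra h
    have hS1 : S.card = 1 := le_antisymm (not_lt.1 h) (Finset.card_pos.2 ⟨1, hone⟩)
    have hY0 : Y = ∅ := by
      refine Finset.eq_empty_of_forall_notMem fun x hx => hred x ?_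
      obtain ⟨a, rfl⟩ := Finset.card_eq_one.1 hS1
      have : gen x ∈ Gp gen Y := Subgroup.subset_closure ⟨x, hx, rfl⟩
      rw [Finset.mem_singleton.1 ((hS _).2 this), Finset.mem_singleton.1 hone]
    rw [hS1, hY0] at hΨY
    have := Psi_nonneg (gen := gen)
    norm_num at hΨY
    linarith
  have hm' : (1 : ℝ) < S.card := by exact_mod_cast hm
  have hm0 : (0 : ℝ) < S.card := by linarith
  have hΨm : Psi gen * (S.card - 1) = (Y.card - 1) * S.card + 1 := by
    have : (S.card : ℝ) - 1 ≠ 0 := by linarith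
    rw [hΨY]
    field_simp
    ring
  have hval : (Y.card - 1 + 1 / (S.card : ℝ) + t / S.card) * S.card =
      (Y.card - 1) * S.card + 1 + t := by
    field_simp
  -- In this form the value is nondecreasing in the order of the subgroup, as `t ≤ Psi`.
  have hval' : Y.card - 1 + 1 / (S.card : ℝ) + t / S.card = Psi gen - (Psi gen - t) / S.card := by
    refine mul_right_cancel₀ hm0.ne' ?_
    rw [hval, ← hΨm]
    field_simp
    ring
  refine le_antisymm ?_ (max_le (Xi_le_profile ht) ?_)
  · rcases (Xi_le_profile (gen := gen) ht).eq_or_lt with hX | hX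
    · exact hX ▸ le_max_left _ _
    refine le_max_of_le_right ?_
    obtain ⟨Z, T, hT, hfull, heq, -⟩ := exists_subgroup_rk_add_eq hgen ht hX
    have hTne : T.Nonempty := ⟨1, (hT 1).2 (one_mem _)⟩
    have hk : (1 : ℝ) ≤ T.card := Nat.one_le_cast.2 hTne.card_pos
    have hk0 : (0 : ℝ) < T.card := by linarith
    have hZY := hmaxY Z (finite_Gp hT)
    have hTval : profile gen t = Z.card - 1 + (1 + t) / T.card := by
      refine mul_right_cancel₀ hk0.ne' ?_
      rw [← heq, rk_Gp hT hfull]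
      field_simp
      ring
    -- A maximizing subgroup `T` at least as large as `S` loses because `|Z| ≤ |Y|`. A smaller one
    -- loses because `rk T ≤ Psi (|T| - 1)` bounds its value by `Psi - (Psi - t) / |T|`.
    rcases le_or_gt S.card T.card with hST | hST
    · have h1 : (1 + t) / T.card ≤ (1 + t) / S.card :=
        div_le_div_of_nonneg_left (by linarith) hm0 (by exact_mod_cast hST)
      have h2 : (Z.card : ℝ) ≤ Y.card := by exact_mod_cast hZY
      rw [hTval]
      linarith [add_div 1 t (S.card : ℝ)]
    · rcases hZY.eq_or_lt with h | h
      · have := hminY Z (finite_Gp hT) h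
        rw [natCard_Gp hT] at this
        omega
      · rw [hval']
        have h1 := rk_le_Psi_of_isReduced hred hTne
        have h2 : profile gen t ≤ Psi gen - (Psi gen - t) / T.card := by
          refine le_of_mul_le_mul_right ?_ hk0
          rw [← heq]
          field_simp
          linarith
        have h3 : (Psi gen - t) / S.card ≤ (Psi gen - t) / T.card :=
          div_le_div_of_nonneg_left (by linarith) hk0 (by exact_mod_cast hST.le)
        linarith
  · refine le_of_mul_le_mul_right ?_ hm0
    rw [hval]
    have := rk_add_le_profile (gen := gen) ht ⟨1, hone⟩
    linarith [le_rk_Gp hS]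

theorem Psi_eq_of_isMinimal (hgen : Subgroup.closure (Set.range gen) = ⊤)
    (hred : IsReduced gen) (hΨ : Xi gen < Psi gen) (hmin : IsMinimal gen)
    {Y : Finset ι} (hY : IsExtremal gen Y) :
    Psi gen = Psi (subGen gen Y) ∧ Psi (subGen gen Y) =
      (Y.card : ℝ) - 1 + (Y.card : ℝ) / ((Nat.card (Gp gen Y) : ℝ) - 1) := by
  obtain ⟨hfin, hmaxY, hminY⟩ := hY
  obtain ⟨S, hS⟩ := exists_finset_Gp (gen := gen) Y
  obtain ⟨Z, T, hT, hfull, heq, hcard⟩ := exists_subgroup_rk_eq_Psi hgen hred hΨ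
  have hfinZ := finite_Gp hT
  have hS1 := card_lt_card_Gp hgen hmin Y hfin
  have hT1 := card_lt_card_Gp hgen hmin Z hfinZ
  have hZY := hmaxY Z hfinZ
  replace hminY := hminY Z hfinZ
  rw [natCard_Gp hS] at hS1 hminY ⊢
  rw [natCard_Gp hT] at hT1 hminY
  have hZ : 0 < Z.card := by
    by_contra h
    obtain rfl : Z = ∅ := Finset.card_eq_zero.1 (by omega)
    obtain ⟨a, ha, b, hb, hab⟩ := Finset.one_lt_card.1 hcard
    simp only [hT, Gp, Finset.coe_empty, Set.image_empty, Subgroup.closure_empty,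
      Subgroup.mem_bot] at ha hb
    exact hab (ha.trans hb.symm)
  have hk : (1 : ℝ) < T.card := by exact_mod_cast hcard
  have hm : (1 : ℝ) < S.card := by exact_mod_cast (by omega : 1 < S.card)
  rw [rk_Gp hT hfull] at heq
  have hΨZ : Psi gen = Z.card - 1 + Z.card / ((T.card : ℝ) - 1) := by
    refine mul_right_cancel₀ (by linarith : (T.card : ℝ) - 1 ≠ 0) ?_
    have : (T.card : ℝ) - 1 ≠ 0 := by linarith
    rw [← heq]
    field_simp
    ring
  have hv : ((Y.card : ℝ) - 1 + Y.card / ((S.card : ℝ) - 1)) * (S.card - 1) =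
      (Y.card - 1) * S.card + 1 := by
    have : (S.card : ℝ) - 1 ≠ 0 := by linarith
    field_simp
    ring
  -- If `|Z| = |Y|`, extremality gives `|S| ≤ |T|`. If `|Z| < |Y|`, minimality gives `|Z| ≤ |T| -
  -- 1`, so the value for `Z` is at most `|Z| ≤ |Y| - 1`.
  have hle : Psi gen ≤ (Y.card : ℝ) - 1 + Y.card / ((S.card : ℝ) - 1) := by
    rw [hΨZ]
    rcases hZY.eq_or_lt with h | h
    · have h1 : (S.card : ℝ) ≤ T.card := by exact_mod_cast hminY h
      rw [h]
      gcongr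
    · have h1 : (Z.card : ℝ) + 1 ≤ Y.card := by exact_mod_cast h
      have h2 : (Z.card : ℝ) / ((T.card : ℝ) - 1) ≤ 1 := by
        rw [div_le_one (by linarith)]
        have : (Z.card : ℝ) + 1 ≤ T.card := by exact_mod_cast hT1
        linarith
      have h3 : (0 : ℝ) ≤ Y.card / ((S.card : ℝ) - 1) :=
        div_nonneg (Nat.cast_nonneg _) (by linarith)
      linarith
  have hnt := nontrivial_Gp hS (by omega)
  have hge : (Y.card : ℝ) - 1 + Y.card / ((S.card : ℝ) - 1) ≤ Psi (subGen gen Y) := by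
    have := Fintype.ofFinite (Gp gen Y)
    refine le_of_mul_le_mul_right ?_ (by linarith : (0 : ℝ) < (S.card : ℝ) - 1)
    have hu : (Finset.univ : Finset (Gp gen Y)).card = S.card := by
      rw [Finset.card_univ, ← Nat.card_eq_fintype_card, natCard_Gp hS]
    rw [hv, ← rk_subGen_univ hS, ← hu]
    exact rk_le_Psi (by rw [hu]; omega)
  have h := Psi_subGen_le (gen := gen) (Y := Y)
  exact ⟨by linarith, by linarith⟩

end Extremal

/-! ### Upper bound for free products: the tree of cosets -/

section FreeProduct

variable {I : Type*} {M : I → Type*} [∀ i, Group (M i)] {G : Type*} [Group G]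

/-- The first letters of the normal forms in a free product: `head i g` is the first letter of `g`
if this belongs to the factor `i`, and `1` otherwise. -/
structure NormalFormHead (of : ∀ i, M i →* G) where
  head : ∀ i, G → M i
  head_one : ∀ i, head i 1 = 1
  head_of_mul : ∀ i m g, head i (of i m * g) = m * head i g
  head_eq_one : ∀ {i k} g, i ≠ k → head i g ≠ 1 → head k g = 1
  head_mul_of : ∀ {i j} g x, (i ≠ j ∨ g ∉ (of i).range) → head i (g * of j x) = head i g

namespace NormalFormHead

variable {of : ∀ i, M i →* G} (F : NormalFormHead of)

theorem head_of (i : I) (m : M i) : F.head i (of i m) = m := by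
  simpa [F.head_one] using F.head_of_mul i m 1

include F in
theorem of_injective (i : I) : Function.Injective (of i) :=
  Function.LeftInverse.injective (F.head_of i)

theorem head_of_ne {i k : I} (h : i ≠ k) (m : M i) : F.head k (of i m) = 1 := by
  by_cases hm : m = 1
  · rw [hm, map_one, F.head_one]
  · exact F.head_eq_one _ h (by rwa [F.head_of])

/-- The projection of the group to the nearest point of a coset of a free factor. -/
def gate (k : Σ i, G ⧸ (of i).range) (v : G) : G :=
  k.2.out * of k.1 (F.head k.1 (k.2.out⁻¹ * v))

/-- The coset of the factor `j` that contains `v`. -/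
def block (of : ∀ i, M i →* G) (v : G) (j : I) : Σ i, G ⧸ (of i).range := ⟨j, (v : G ⧸ (of j).range)⟩

theorem exists_eq_out_mul {i : I} {q : G ⧸ (of i).range} {v : G}
    (h : (v : G ⧸ (of i).range) = q) : v = q.out * of i (F.head i (q.out⁻¹ * v)) := by
  have h1 : q.out⁻¹ * v ∈ (of i).range := by
    rw [← QuotientGroup.eq, QuotientGroup.out_eq', h]
  obtain ⟨m, hm⟩ := h1
  rw [← hm, F.head_of, hm, mul_inv_cancel_left]

theorem gate_eq_self {v : G} {j : I} : F.gate (block of v j) v = v :=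
  (F.exists_eq_out_mul rfl).symm

theorem block_mul (v : G) (j : I) (x : M j) : block of (v * of j x) j = block of v j := by
  have : ((v * of j x : G) : G ⧸ (of j).range) = v := by
    rw [QuotientGroup.mk_mul_of_mem _ (MonoidHom.mem_range.2 ⟨x, rfl⟩)]
  rw [block, this, block]

/-- The tree-like structure in usable form: an edge in another block projects to a single vertex of
block `k`. -/
theorem gate_mul {k : Σ i, G ⧸ (of i).range} {v : G} {j : I} (x : M j) (h : block of v j ≠ k) :
    F.gate k (v * of j x) = F.gate k v := by
  obtain ⟨i, q⟩ := k
  rw [gate, gate, ← mul_assoc, F.head_mul_of]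
  by_cases hij : i = j
  · subst hij
    refine Or.inr fun hmem => h ?_
    rw [← QuotientGroup.eq, QuotientGroup.out_eq'] at hmem
    exact congrArg (Sigma.mk i) hmem.symm
  · exact Or.inl hij

/-- The blocks that meet a set of vertices. -/
def blocks (of : ∀ i, M i →* G) (T : Finset G) (i : I) : Finset (G ⧸ (of i).range) :=
  T.image fun v : G => (v : G ⧸ (of i).range)

theorem mem_blocks {T : Finset G} {v : G} (hv : v ∈ T) (i : I) :
    (v : G ⧸ (of i).range) ∈ blocks of T i :=
  Finset.mem_image_of_mem (fun v : G => (v : G ⧸ (of i).range)) hv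

/-- The part of a set of vertices in a block, moved to the free factor. -/
def blockPart (T : Finset G) (i : I) (q : G ⧸ (of i).range) : Finset (M i) :=
  (T.filter fun v : G => (v : G ⧸ (of i).range) = q).image fun v => F.head i (q.out⁻¹ * v)

theorem card_blockPart (T : Finset G) (i : I) (q : G ⧸ (of i).range) :
    (F.blockPart T i q).card = (T.filter fun v : G => (v : G ⧸ (of i).range) = q).card := by
  refine Finset.card_image_of_injOn fun v hv w hw h => ?_
  rw [F.exists_eq_out_mul (Finset.mem_filter.1 hv).2, F.exists_eq_out_mul (Finset.mem_filter.1 hw).2]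
  exact congrArg (fun m => q.out * of i m) h

theorem sum_card_blockPart (T : Finset G) (i : I) :
    ∑ q ∈ blocks of T i, (F.blockPart T i q).card = T.card := by
  simp_rw [F.card_blockPart]
  exact (Finset.card_eq_sum_card_image (fun v : G => (v : G ⧸ (of i).range)) T).symm

theorem blockPart_nonempty {T : Finset G} {i : I} {q : G ⧸ (of i).range} (hq : q ∈ blocks of T i) :
    (F.blockPart T i q).Nonempty := by
  obtain ⟨v, hv, rfl⟩ := Finset.mem_image.1 hq
  exact ⟨_, Finset.mem_image_of_mem _ (Finset.mem_filter (p := fun w : G => (w : G ⧸ (of i).range) = v) |>.2 ⟨hv, rfl⟩)⟩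

variable [Fintype I]

include F in
/-- The tree-like arrangement of the blocks. -/
theorem card_mul_card_lt {T : Finset G} (hT : T.Nonempty) :
    Fintype.card I * T.card + 1 ≤ T.card + ∑ i, (blocks of T i).card := by
  have hrep : ∀ i, ∀ q : G ⧸ (of i).range, ∃ u : G, (u : G ⧸ (of i).range) = q ∧
      (q ∈ blocks of T i → u ∈ T) := by
    intro i q
    by_cases h : q ∈ blocks of T i
    · obtain ⟨u, hu, rfl⟩ := Finset.mem_image.1 h
      exact ⟨u, rfl, fun _ => hu⟩
    · exact ⟨q.out, q.out_eq', fun h' => absurd h' h⟩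
  choose rep hrep hrepT using hrep
  -- In every block join each vertex of `T` to the chosen representative: a star in each block, with
  -- `A` leaving out the loops.
  let tgt : G × I → G := fun e => rep e.2 e.1
  let A : Finset (G × I) := (T ×ˢ Finset.univ).filter fun e => e.1 ≠ tgt e
  have hA : ∀ e, e ∈ A ↔ e.1 ∈ T ∧ e.1 ≠ tgt e := by simp [A]
  have htgt : ∀ e : G × I, ∃ m, tgt e = e.1 * of e.2 m := by
    intro e
    obtain ⟨m, hm⟩ := QuotientGroup.eq.1 (hrep e.2 e.1).symm
    exact ⟨m, by rw [hm, mul_inv_cancel_left]⟩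
  -- The gates split a cycle into block parts. In a star, `e` is the only edge starting at `e.1`,
  -- and no edge ends there, so its coefficient vanishes.
  have hrank : cycleRank Prod.fst tgt A = 0 := by
    rw [cycleRank, Submodule.finrank_eq_zero, eq_bot_iff]
    intro f hf
    rw [Submodule.mem_bot]
    ext e
    by_contra hfe
    have he : e ∈ A := (mem_cycleSpace.1 hf).1 (Finsupp.mem_support_iff.2 hfe)
    have h := filter_mem_cycleSpace hf (fun e' => block of e'.1 e'.2 = block of e.1 e.2)
      (F.gate (block of e.1 e.2)) ?_ ?_
    · rw [mem_cycleSpace] at h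
      obtain ⟨hsupp, h⟩ := h
      have h1 := DFunLike.congr_fun h e.1
      rw [Finsupp.mapDomain_apply' _ _ hsupp ?_ ⟨he, rfl⟩, Finsupp.filter_apply_pos (fun e' : G × I => block of e'.1 e'.2 = block of e.1 e.2) f rfl] at h1
      · refine hfe (h1.symm.trans ?_)
        by_contra hne
        obtain ⟨e', he', h2⟩ := Finset.mem_image.1
          (Finsupp.mapDomain_support (Finsupp.mem_support_iff.2 hne))
        obtain ⟨h3, h4⟩ := hsupp he'
        refine ((hA e).1 he).2 ?_
        rw [← h2]
        exact congrArg (fun k : Σ i, G ⧸ (of i).range => rep k.1 k.2) h4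
      · rintro ⟨v, i⟩ ⟨-, hv⟩ ⟨w, j⟩ ⟨-, hw⟩ (rfl : v = w)
        have := congrArg Sigma.fst (hv.trans hw.symm)
        exact Prod.ext rfl this
    · rintro e' - he'
      obtain ⟨m, hm⟩ := htgt e'
      rw [← he', hm]
      refine ⟨F.gate_eq_self, ?_⟩
      have := F.gate_eq_self (v := e'.1 * of e'.2 m) (j := e'.2)
      rwa [block_mul] at this
    · rintro e' - he'
      obtain ⟨m, hm⟩ := htgt e'
      rw [hm, F.gate_mul m he']
  have h1 := card_add_finrank_locallyConstant (s := Prod.fst) (t := tgt) T A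
    (fun e he => ((hA e).1 he).1)
    (fun e he => hrepT _ _ (mem_blocks ((hA e).1 he).1 _))
  have h2 : 1 ≤ Module.finrank ℚ (locallyConstant Prod.fst tgt T A) := by
    obtain ⟨v, hv⟩ := hT
    rw [Nat.one_le_iff_ne_zero, Ne, Submodule.finrank_eq_zero]
    intro hbot
    have : (fun _ => 1 : T → ℚ) ∈ locallyConstant Prod.fst tgt T A := fun _ _ _ _ => rfl
    rw [hbot, Submodule.mem_bot] at this
    exact one_ne_zero (congrFun this ⟨v, hv⟩)
  -- At most one vertex per block is its own representative.
  have h3 : ∀ i, T.card ≤ (T.filter fun v => v ≠ tgt (v, i)).card + (blocks of T i).card := by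
    intro i
    rw [← Finset.card_filter_add_card_filter_not (s := T) (fun v => v ≠ tgt (v, i))]
    refine Nat.add_le_add_left (Finset.card_le_card_of_injOn (fun v : G => (v : G ⧸ (of i).range))
      (fun v hv => mem_blocks (Finset.mem_filter.1 hv).1 i) ?_) _
    intro v hv w hw hvw
    have hv' := not_not.1 (Finset.mem_filter.1 hv).2
    have hw' := not_not.1 (Finset.mem_filter.1 hw).2
    rw [hv', hw']
    exact congrArg (rep i) hvw
  have h4 : A.card = ∑ i, (T.filter fun v => v ≠ tgt (v, i)).card := by
    rw [Finset.card_filter, Finset.sum_product_right]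
    simp_rw [Finset.card_filter]
  have h5 := Finset.sum_le_sum fun i (_ : i ∈ Finset.univ) => h3 i
  rw [Finset.sum_const, Finset.card_univ, smul_eq_mul, Finset.sum_add_distrib, ← h4] at h5
  omega

variable {X : I → Type*} [∀ i, Fintype (X i)] {γ : ∀ i, X i → M i} {gen : (Σ i, X i) → G}

/-- Colour each edge by the coset containing it; the gates are the retractions needed for
`cycleRank_le_sum`. -/
theorem rk_le_sum_blockPart (hgen : ∀ x, gen x = of x.1 (γ x.1 x.2)) (T : Finset G) :
    rk gen T ≤ ∑ i, ∑ q ∈ blocks of T i, rk (γ i) (F.blockPart T i q) := by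
  have h := cycleRank_le_sum (s := Prod.fst) (t := target gen) (fullSubgraph gen T).edges
    (fun e => block of e.1 e.2.1) F.gate ?_ ?_
  · refine h.trans ?_
    rw [← Finset.sum_sigma (Finset.univ) (blocks of T)
      fun k => rk (γ k.1) (F.blockPart T k.1 k.2)]
    refine (Finset.sum_le_sum fun k _ => ?_).trans (Finset.sum_le_sum_of_subset ?_)
    · obtain ⟨i, q⟩ := k
      rw [← cycleRank_image_hom (gen := gen) (gen' := γ i) (of i) (F.of_injective i) (Sigma.mk i)
        sigma_mk_injective (fun x => hgen ⟨i, x⟩) q.out]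
      refine cycleRank_mono fun e he => ?_
      obtain ⟨g, j, x⟩ := e
      obtain ⟨he, hk⟩ := Finset.mem_filter.1 he
      obtain ⟨h1, h2⟩ := mem_fullSubgraph_edges.1 he
      obtain rfl : j = i := congrArg Sigma.fst hk
      have hq : (g : G ⧸ (of j).range) = q := by simpa [block] using hk
      have hq' : ((g * gen ⟨j, x⟩ : G) : G ⧸ (of j).range) = q := by
        rw [← hq, hgen, QuotientGroup.mk_mul_of_mem _ (MonoidHom.mem_range.2 ⟨_, rfl⟩)]
      have hg := F.exists_eq_out_mul hq
      refine Finset.mem_image.2 ⟨(F.head j (q.out⁻¹ * g), x), mem_fullSubgraph_edges.2 ⟨?_, ?_⟩, ?_⟩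
      · exact Finset.mem_image_of_mem _ (Finset.mem_filter.2 ⟨h1, hq⟩)
      · have h3 := Finset.mem_image_of_mem (fun v => F.head j (q.out⁻¹ * v))
          (Finset.mem_filter (p := fun v : G => (v : G ⧸ (of j).range) = q) |>.2 ⟨h2, hq'⟩)
        have h4 : F.head j (q.out⁻¹ * (g * gen ⟨j, x⟩)) = F.head j (q.out⁻¹ * g) * γ j x := by
          conv_lhs => rw [hg, hgen, mul_assoc, ← map_mul, inv_mul_cancel_left, F.head_of]
        rwa [h4] at h3
      · exact Prod.ext hg.symm rfl
    · intro k hk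
      obtain ⟨e, he, rfl⟩ := Finset.mem_image.1 hk
      exact Finset.mem_sigma.2 ⟨Finset.mem_univ _,
        mem_blocks (mem_fullSubgraph_edges.1 he).1 _⟩
  · rintro ⟨g, j, x⟩ -
    refine ⟨F.gate_eq_self, ?_⟩
    have := F.gate_eq_self (v := g * of j (γ j x)) (j := j)
    rwa [block_mul, ← hgen ⟨j, x⟩] at this
  · rintro k - ⟨g, j, x⟩ - hk
    rw [target, hgen, F.gate_mul _ hk]

include F in
-- Every block costs one `t`: a part `P` gives at most `t (|P| - 1)` in the other factors and `c |P|
-- - t` in factor `i₁`. The total is `c |T| + t ((r - 1) |T| - #blocks)` for `r` factors, and there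
-- are more than `(r - 1) |T|` blocks.
theorem Xi_le_profile_factor (hgen : ∀ x, gen x = of x.1 (γ x.1 x.2)) (i₁ : I) {t : ℝ}
    (ht : 0 ≤ t) (h : ∀ j ≠ i₁, ∀ S : Finset (M j), S.Nonempty →
      (rk (γ j) S : ℝ) ≤ t * (S.card - 1)) :
    Xi gen ≤ profile (γ i₁) t := by
  refine Xi_le fun T hT => ?_
  set c := profile (γ i₁) t
  have h1 : (rk gen T : ℝ) ≤ ∑ i, ∑ q ∈ blocks of T i, (rk (γ i) (F.blockPart T i q) : ℝ) := by
    exact_mod_cast F.rk_le_sum_blockPart hgen T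
  have h2 : (Fintype.card I * T.card + 1 : ℝ) ≤ T.card + ∑ i, ((blocks of T i).card : ℝ) := by
    exact_mod_cast F.card_mul_card_lt hT
  have hsum : ∀ i, ∑ q ∈ blocks of T i, ((F.blockPart T i q).card : ℝ) = T.card := fun i => by
    exact_mod_cast F.sum_card_blockPart T i
  have h3 : ∀ i ≠ i₁, ∑ q ∈ blocks of T i, (rk (γ i) (F.blockPart T i q) : ℝ) ≤
      t * (T.card - (blocks of T i).card) := by
    intro i hi
    refine (Finset.sum_le_sum fun q hq => h i hi _ (F.blockPart_nonempty hq)).trans (le_of_eq ?_)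
    rw [← Finset.mul_sum, Finset.sum_sub_distrib, hsum]
    simp
  have h4 : ∑ q ∈ blocks of T i₁, (rk (γ i₁) (F.blockPart T i₁ q) : ℝ) ≤
      c * T.card - t * (blocks of T i₁).card := by
    have : ∀ q ∈ blocks of T i₁, (rk (γ i₁) (F.blockPart T i₁ q) : ℝ) ≤
        c * (F.blockPart T i₁ q).card - t := fun q hq => by
      linarith [rk_add_le_profile (gen := γ i₁) ht (F.blockPart_nonempty hq)]
    refine (Finset.sum_le_sum this).trans (le_of_eq ?_)
    rw [Finset.sum_sub_distrib, ← Finset.mul_sum, hsum]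
    simp [mul_comm]
  rw [← Finset.add_sum_erase _ _ (Finset.mem_univ i₁)] at h1
  have h5 := Finset.sum_le_sum fun i (hi : i ∈ Finset.univ.erase i₁) =>
    h3 i (Finset.ne_of_mem_erase hi)
  have h6 : ∑ i ∈ Finset.univ.erase i₁, t * ((T.card : ℝ) - (blocks of T i).card) =
      t * (Fintype.card I * T.card - ∑ i, ((blocks of T i).card : ℝ)) -
        t * (T.card - (blocks of T i₁).card) := by
    rw [eq_sub_iff_add_eq, Finset.sum_erase_add _ _ (Finset.mem_univ i₁), ← Finset.mul_sum,
      Finset.sum_sub_distrib]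
    simp
  nlinarith

end NormalFormHead
end FreeProduct

theorem cycleRank_add_le_of_disjoint {V E : Type*} {s t : E → V} {A B C : Finset E}
    (hAB : Disjoint A B) (hA : A ⊆ C) (hB : B ⊆ C) :
    cycleRank s t A + cycleRank s t B ≤ cycleRank s t C := by
  refine (cycleRank_add_le A B).trans ?_
  rw [Finset.disjoint_iff_inter_eq_empty.1 hAB, cycleRank_empty, add_zero]
  exact cycleRank_mono (Finset.union_subset hA hB)

/-! ### Lower bound for free products: gluing copies into trees -/

section FreeProduct

variable {I : Type*} {M : I → Type*} [∀ i, Group (M i)] {G : Type*} [Group G] [Fintype I]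
  {of : ∀ i, M i →* G} (F : NormalFormHead of)
  {i₁ i₂ : I} {X : I → Type*} [∀ i, Fintype (X i)] {γ : ∀ i, X i → M i} {gen : (Σ i, X i) → G}

namespace NormalFormHead

include F in
/-- One step in the construction of a tree-like union of copies of `B` and `S`. -/
theorem exists_tree_step (hgen : ∀ x, gen x = of x.1 (γ x.1 x.2)) (hne : i₁ ≠ i₂)
    (hred : IsReduced (γ i₂)) {B : Finset (M i₁)} {b : M i₁} (hb : b ∈ B) (hb1 : b ≠ 1)
    (hB1 : 1 ∈ B) {S : Finset (M i₂)} (hS1 : 1 ∈ S)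
    {T : Finset G} (hT : ∀ v ∈ T, F.head i₂ v = 1) (hT1 : 1 ∈ T) :
    ∃ T' : Finset G, (∀ v ∈ T', F.head i₂ v = 1) ∧ 1 ∈ T' ∧
      T'.card ≤ B.card + (S.card - 1) * T.card ∧
      rk (γ i₁) B + rk (γ i₂) S + (S.card - 1) * rk gen T ≤ rk gen T' := by
  -- Attach a copy of `S` to `B` at the vertex `b`, and hang a copy of `T` on each vertex of it
  -- other than `b`. No vertex of `T` starts with a letter of factor `i₂`, which keeps the pieces
  -- apart.
  let C (s : M i₂) : Finset G := T.image (of i₁ b * of i₂ s * ·)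
  let T' : Finset G := B.image (of i₁) ∪ (S.erase 1).biUnion C
  have hBT : ∀ {a}, a ∈ B → of i₁ a ∈ T' := fun ha =>
    Finset.mem_union_left _ (Finset.mem_image_of_mem _ ha)
  have hCT : ∀ {s v}, s ∈ S.erase 1 → v ∈ C s → v ∈ T' := fun hs hv =>
    Finset.mem_union_right _ (Finset.mem_biUnion.2 ⟨_, hs, hv⟩)
  -- `ρ` tells the pieces apart: it is `1` on `B`, constantly `s` on `C s`, and changes along every
  -- edge of the copy of `S`.
  let ρ (v : G) : M i₂ := F.head i₂ ((of i₁ b)⁻¹ * v)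
  have hρB : ∀ a, ρ (of i₁ a) = 1 := fun a => by
    simp only [ρ, ← map_inv, ← map_mul]
    exact F.head_of_ne hne _
  have hρC : ∀ s, ∀ v ∈ C s, ρ v = s := by
    intro s v hv
    obtain ⟨u, hu, rfl⟩ := Finset.mem_image.1 hv
    simp only [ρ]
    rw [mul_assoc, inv_mul_cancel_left, F.head_of_mul, hT u hu, mul_one]
  have hρS : ∀ s, ρ (of i₁ b * of i₂ s) = s := fun s => by
    simp only [ρ]
    rw [inv_mul_cancel_left, F.head_of]
  have hST : ∀ {s}, s ∈ S → of i₁ b * of i₂ s ∈ T' := by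
    intro s hs
    by_cases h1 : s = 1
    · rw [h1, map_one, mul_one]
      exact hBT hb
    · exact hCT (Finset.mem_erase.2 ⟨h1, hs⟩) (Finset.mem_image.2 ⟨1, hT1, mul_one _⟩)
  refine ⟨T', ?_, by simpa using hBT hB1, ?_, ?_⟩
  · intro v hv
    rcases Finset.mem_union.1 hv with hv | hv
    · obtain ⟨a, -, rfl⟩ := Finset.mem_image.1 hv
      exact F.head_of_ne hne _
    · obtain ⟨s, hs, hv⟩ := Finset.mem_biUnion.1 hv
      obtain ⟨u, hu, rfl⟩ := Finset.mem_image.1 hv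
      refine F.head_eq_one _ hne ?_
      rw [mul_assoc, F.head_of_mul, F.head_eq_one _ hne.symm, mul_one]
      · exact hb1
      · rw [F.head_of_mul, hT u hu, mul_one]
        exact (Finset.mem_erase.1 hs).1
  · refine (Finset.card_union_le _ _).trans (Nat.add_le_add Finset.card_image_le ?_)
    rw [← Finset.card_erase_of_mem hS1]
    exact Finset.card_biUnion_le_card_mul _ _ _ fun s _ => Finset.card_image_le
  · let E₁ : Finset (G × Σ i, X i) := (fullSubgraph (γ i₁) B).edges.image
      (Prod.map (fun v => 1 * of i₁ v) (Sigma.mk i₁))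
    let E₂ : Finset (G × Σ i, X i) := (fullSubgraph (γ i₂) S).edges.image
      (Prod.map (fun v => of i₁ b * of i₂ v) (Sigma.mk i₂))
    let E₃ (s : M i₂) : Finset (G × Σ i, X i) := (fullSubgraph gen (C s)).edges
    have r₁ : cycleRank Prod.fst (target gen) E₁ = rk (γ i₁) B :=
      cycleRank_image_hom (gen := gen) (gen' := γ i₁) (of i₁) (F.of_injective i₁) (Sigma.mk i₁)
        sigma_mk_injective (fun x => hgen ⟨i₁, x⟩) 1 B
    have r₂ : cycleRank Prod.fst (target gen) E₂ = rk (γ i₂) S :=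
      cycleRank_image_hom (gen := gen) (gen' := γ i₂) (of i₂) (F.of_injective i₂) (Sigma.mk i₂)
        sigma_mk_injective (fun x => hgen ⟨i₂, x⟩) (of i₁ b) S
    have r₃ : ∀ s, cycleRank Prod.fst (target gen) (E₃ s) = rk gen T := fun s => rk_image_mul _ _
    have m₁ : ∀ e ∈ E₁, e.2.1 = i₁ ∧ ρ e.1 = 1 ∧ e.1 ∈ T' ∧ e.1 * gen e.2 ∈ T' := by
      intro e he
      obtain ⟨⟨a, x⟩, hax, rfl⟩ := Finset.mem_image.1 he
      obtain ⟨h1, h2⟩ := mem_fullSubgraph_edges.1 hax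
      simp only [Prod.map_apply, one_mul, hgen, ← map_mul]
      exact ⟨trivial, hρB a, hBT h1, hBT h2⟩
    have m₂ : ∀ e ∈ E₂, e.2.1 = i₂ ∧ ρ (e.1 * gen e.2) ≠ ρ e.1 ∧ e.1 ∈ T' ∧
        e.1 * gen e.2 ∈ T' := by
      intro e he
      obtain ⟨⟨a, x⟩, hax, rfl⟩ := Finset.mem_image.1 he
      obtain ⟨h1, h2⟩ := mem_fullSubgraph_edges.1 hax
      simp only [Prod.map_apply, hgen, mul_assoc, ← map_mul]
      refine ⟨trivial, ?_, hST h1, hST h2⟩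
      rw [hρS, hρS, Ne, mul_eq_left]
      exact hred x
    have m₃ : ∀ s, ∀ e ∈ E₃ s, ρ e.1 = s ∧ ρ (e.1 * gen e.2) = s := fun s e he =>
      ⟨hρC s _ (mem_fullSubgraph_edges.1 he).1, hρC s _ (mem_fullSubgraph_edges.1 he).2⟩
    have s₁ : E₁ ⊆ (fullSubgraph gen T').edges := fun e he =>
      mem_fullSubgraph_edges.2 (m₁ e he).2.2
    have s₂ : E₂ ⊆ (fullSubgraph gen T').edges := fun e he =>
      mem_fullSubgraph_edges.2 (m₂ e he).2.2
    have s₃ : ∀ s ∈ S.erase 1, E₃ s ⊆ (fullSubgraph gen T').edges := fun s hs e he =>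
      mem_fullSubgraph_edges.2 ⟨hCT hs (mem_fullSubgraph_edges.1 he).1,
        hCT hs (mem_fullSubgraph_edges.1 he).2⟩
    have d₁ : Disjoint E₁ (E₂ ∪ (S.erase 1).biUnion E₃) := by
      rw [Finset.disjoint_left]
      intro e h1 h2
      rcases Finset.mem_union.1 h2 with h2 | h2
      · exact hne ((m₁ e h1).1.symm.trans (m₂ e h2).1)
      · obtain ⟨s, hs, h2⟩ := Finset.mem_biUnion.1 h2
        exact (Finset.mem_erase.1 hs).1 ((m₃ s e h2).1.symm.trans (m₁ e h1).2.1)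
    have d₂ : Disjoint E₂ ((S.erase 1).biUnion E₃) := by
      rw [Finset.disjoint_left]
      intro e h1 h2
      obtain ⟨s, hs, h2⟩ := Finset.mem_biUnion.1 h2
      exact (m₂ e h1).2.1 ((m₃ s e h2).2.trans (m₃ s e h2).1.symm)
    have d₃ : ((S.erase 1 : Finset (M i₂)) : Set (M i₂)).PairwiseDisjoint E₃ := by
      intro s _ s' _ hss'
      rw [Function.onFun, Finset.disjoint_left]
      intro e h1 h2
      exact hss' ((m₃ s e h1).1.symm.trans (m₃ s' e h2).1)
    have c₃ := sum_cycleRank_le (s := Prod.fst) (t := target gen) d₃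
      (fun s hs => Finset.subset_biUnion_of_mem E₃ hs)
    have c₂ := cycleRank_add_le_of_disjoint (s := Prod.fst) (t := target gen) d₂
      Finset.subset_union_left Finset.subset_union_right
    have c₁ := cycleRank_add_le_of_disjoint (s := Prod.fst) (t := target gen) d₁ s₁
      (Finset.union_subset s₂ (Finset.biUnion_subset.2 s₃))
    simp only [r₃, Finset.sum_const, Finset.card_erase_of_mem hS1, smul_eq_mul] at c₃
    rw [r₂] at c₂
    rw [r₁] at c₁
    change _ ≤ rk gen T' at c₁
    omega

include F in
-- `N` counts the copies of `B`; then there are `(N - 1) / (|S| - 1)` copies of `S`, which need no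
-- vertices beyond those of the copies of `B`. The rank estimate is stated with denominators
-- cleared.
theorem exists_tree (hgen : ∀ x, gen x = of x.1 (γ x.1 x.2)) (hne : i₁ ≠ i₂)
    (hred : IsReduced (γ i₂)) {B : Finset (M i₁)} (hB : 1 < B.card) (hB1 : 1 ∈ B)
    {S : Finset (M i₂)} (hS : 1 < S.card) (hS1 : 1 ∈ S) (n : ℕ) :
    ∃ (T : Finset G) (N : ℕ), (∀ v ∈ T, F.head i₂ v = 1) ∧ 1 ∈ T ∧ n ≤ N ∧
      T.card ≤ B.card * N ∧
      ((S.card - 1) * rk (γ i₁) B + rk (γ i₂) S) * N ≤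
        (S.card - 1) * rk gen T + rk (γ i₂) S := by
  obtain ⟨b, hb, hb1⟩ := Finset.exists_mem_ne hB 1
  obtain ⟨q, hq⟩ : ∃ q, S.card - 1 = q + 1 := ⟨S.card - 2, by omega⟩
  induction n with
  | zero =>
    refine ⟨B.image (of i₁), 1, ?_, Finset.mem_image.2 ⟨1, hB1, map_one _⟩, by simp,
      by simpa using Finset.card_image_le, ?_⟩
    · intro v hv
      obtain ⟨a, -, rfl⟩ := Finset.mem_image.1 hv
      exact F.head_of_ne hne _
    · have := rk_le_rk_image_hom (gen := gen) (gen' := γ i₁) (of i₁) (F.of_injective i₁)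
        (Sigma.mk i₁) sigma_mk_injective (fun x => hgen ⟨i₁, x⟩) B
      rw [mul_one]
      exact Nat.add_le_add_right (Nat.mul_le_mul_left _ this) _
  | succ n ih =>
    obtain ⟨T, N, hT, hT1, hn, hcard, hrk⟩ := ih
    obtain ⟨T', hT', hT1', hcard', hrk'⟩ := F.exists_tree_step hgen hne hred hb hb1 hB1 hS1 hT hT1
    rw [hq] at hrk hcard' hrk' ⊢
    refine ⟨T', 1 + (q + 1) * N, hT', hT1', ?_, ?_, ?_⟩
    · nlinarith
    · nlinarith
    · nlinarith [Nat.mul_le_mul_left (q + 1) hrk, Nat.mul_le_mul_left (q + 1) hrk']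

theorem exists_image_mul_one_mem {H : Type*} [Group H] {κ : Type*} [Fintype κ] (δ : κ → H)
    {S : Finset H} (hS : S.Nonempty) :
    ∃ S' : Finset H, 1 ∈ S' ∧ S'.card = S.card ∧ rk δ S' = rk δ S := by
  obtain ⟨a, ha⟩ := hS
  exact ⟨S.image (a⁻¹ * ·), Finset.mem_image.2 ⟨a, ha, by simp⟩,
    Finset.card_image_of_injective _ (mul_right_injective _), rk_image_mul _ _⟩

include F in
-- In large trees the rank per copy of `B` tends to at least `rk B + rk S / (|S| - 1)`, at a cost of
-- at most `|B|` vertices; take the supremum over `S`.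
theorem rk_add_Psi_le [Nontrivial (M i₂)] (hgen : ∀ x, gen x = of x.1 (γ x.1 x.2))
    (hcl : Subgroup.closure (Set.range gen) = ⊤) (hne : i₁ ≠ i₂)
    (hred : IsReduced (γ i₂)) {B : Finset (M i₁)} (hB : 1 < B.card) :
    rk (γ i₁) B + Psi (γ i₂) ≤ Xi gen * B.card := by
  obtain ⟨B', hB1, hBc, hBr⟩ := exists_image_mul_one_mem (γ i₁) (S := B) (Finset.card_pos.1 (by omega))
  rw [← hBc] at hB ⊢
  rw [← hBr]
  suffices Psi (γ i₂) ≤ Xi gen * B'.card - rk (γ i₁) B' by linarith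
  refine Psi_le fun S hS => ?_
  obtain ⟨S', hS1, hSc, hSr⟩ := exists_image_mul_one_mem (γ i₂) (S := S) (Finset.card_pos.1 (by omega))
  rw [← hSc] at hS ⊢
  rw [← hSr]
  by_contra! hlt
  have hS0 : (1 : ℝ) < S'.card := by exact_mod_cast hS
  -- `d` is the assumed excess per copy of `B`, scaled by `|S'| - 1`; the trees give `N d ≤ rk S'`
  -- for arbitrarily large `N`.
  set d : ℝ := rk (γ i₂) S' - (Xi gen * B'.card - rk (γ i₁) B') * (S'.card - 1) with hd
  have hd0 : 0 < d := by linarith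
  obtain ⟨n, hn⟩ := exists_nat_gt (rk (γ i₂) S' / d)
  rw [div_lt_iff₀ hd0] at hn
  obtain ⟨T, N, -, -, hnN, hcard, hrk⟩ := F.exists_tree hgen hne hred hB hB1 hS hS1 n
  have h1 : ((S'.card - 1 : ℝ) * rk (γ i₁) B' + rk (γ i₂) S') * N ≤
      (S'.card - 1) * rk gen T + rk (γ i₂) S' := by
    have : ((((S'.card - 1 : ℕ) * rk (γ i₁) B' + rk (γ i₂) S') * N : ℕ) : ℝ) ≤ _ :=
      Nat.cast_le.2 hrk
    push_cast [Nat.cast_sub hS.le] at this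
    exact this
  have h2 : (T.card : ℝ) ≤ B'.card * N := by exact_mod_cast hcard
  have h3 : (rk gen T : ℝ) ≤ Xi gen * (B'.card * N) :=
    (rk_le_Xi hcl T).trans (mul_le_mul_of_nonneg_left h2 (Xi_nonneg hcl))
  have h4 : (S'.card - 1 : ℝ) * rk gen T ≤ (S'.card - 1) * (Xi gen * (B'.card * N)) :=
    mul_le_mul_of_nonneg_left h3 (by linarith)
  have h5 : (n : ℝ) * d ≤ N * d := mul_le_mul_of_nonneg_right (Nat.cast_le.2 hnN) hd0.le
  have h6 : (N : ℝ) * d ≤ rk (γ i₂) S' := by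
    rw [hd]
    linarith
  linarith

include F in
/-- The cyclomatic quotient of a free product in terms of two of the factors. -/
theorem Xi_eq_profile [Nontrivial (M i₁)] [Nontrivial (M i₂)]
    (hgen : ∀ x, gen x = of x.1 (γ x.1 x.2))
    (hcl : Subgroup.closure (Set.range gen) = ⊤) (hne : i₁ ≠ i₂)
    (hred : ∀ i, IsReduced (γ i)) (h₁₂ : Psi (γ i₂) ≤ Psi (γ i₁))
    (hle : ∀ j ≠ i₁, Psi (γ j) ≤ Psi (γ i₂)) :
    Xi gen = profile (γ i₁) (Psi (γ i₂)) := by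
  refine le_antisymm (F.Xi_le_profile_factor hgen i₁ Psi_nonneg fun j hj S hS => ?_)
    (profile_le fun B hB => ?_)
  · refine (rk_le_Psi_of_isReduced (hred j) hS).trans
      (mul_le_mul_of_nonneg_right (hle j hj) ?_)
    have : (1 : ℝ) ≤ S.card := Nat.one_le_cast.2 hS.card_pos
    linarith
  · rcases (Nat.succ_le_of_lt hB.card_pos).eq_or_lt with h | h
    · obtain ⟨g, rfl⟩ := Finset.card_eq_one.1 h.symm
      rw [rk_singleton (hred i₁), Finset.card_singleton, Nat.cast_zero, zero_add, Nat.cast_one,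
        mul_one]
      -- For a singleton the claim is `Psi (γ i₂) ≤ Xi gen`. If it failed, the bound for larger sets
      -- would give `Psi (γ i₁) ≤ Xi gen < Psi (γ i₂)`.
      by_contra! hlt
      have : Psi (γ i₁) ≤ Xi gen := by
        refine Psi_le fun B hB => ?_
        have := F.rk_add_Psi_le hgen hcl hne (hred i₂) hB
        linarith
      linarith
    · exact F.rk_add_Psi_le hgen hcl hne (hred i₂) h

end NormalFormHead
end FreeProduct

/-! ### First letters of reduced words -/

section NormalForm

open Monoid

variable {I : Type*} {M : I → Type*} [∀ i, Group (M i)]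

/-- The first letter of the reduced word of an element of a free product, if it belongs to the
factor `i`. -/
def firstLetter (i : I) (g : CoprodI M) : M i :=
  (CoprodI.Word.equivPair i (CoprodI.Word.equiv g)).head

theorem firstLetter_of_mul (i : I) (m : M i) (g : CoprodI M) :
    firstLetter i (CoprodI.of m * g) = m * firstLetter i g := by
  change (CoprodI.Word.equivPair i
    ((CoprodI.of m * g) • (CoprodI.Word.empty : CoprodI.Word M))).head = _
  rw [mul_smul, CoprodI.Word.equivPair_smul_same]
  rfl

theorem firstLetter_eq_one_of_fstIdx {i : I} {g : CoprodI M}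
    (h : (CoprodI.Word.equiv g).fstIdx ≠ some i) : firstLetter i g = 1 := by
  rw [firstLetter, CoprodI.Word.equivPair_eq_of_fstIdx_ne h]

theorem firstLetter_one (i : I) : firstLetter i (1 : CoprodI M) = 1 := by
  refine firstLetter_eq_one_of_fstIdx ?_
  change ((1 : CoprodI M) • (CoprodI.Word.empty : CoprodI.Word M)).fstIdx ≠ some i
  rw [one_smul]
  simp [CoprodI.Word.fstIdx, CoprodI.Word.empty]

theorem firstLetter_eq_one {i k : I} (g : CoprodI M) (h : i ≠ k) (hg : firstLetter i g ≠ 1) :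
    firstLetter k g = 1 := by
  refine firstLetter_eq_one_of_fstIdx fun hk => hg (firstLetter_eq_one_of_fstIdx fun hi => h ?_)
  rw [hi] at hk
  exact Option.some.inj hk

theorem firstLetter_induction {motive : CoprodI M → Prop} (one : motive 1)
    (mul : ∀ k (m : M k) g, m ≠ 1 → firstLetter k g = 1 → motive g → motive (CoprodI.of m * g))
    (g : CoprodI M) : motive g := by
  obtain ⟨w, rfl⟩ := CoprodI.Word.equiv.symm.surjective g
  change motive w.prod
  induction w using CoprodI.Word.consRecOn with
  | empty => rwa [CoprodI.Word.prod_empty]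
  | cons i m w h1 h2 ih =>
    rw [CoprodI.Word.prod_cons]
    refine mul i m _ h2 (firstLetter_eq_one_of_fstIdx ?_) ih
    rwa [show CoprodI.Word.equiv w.prod = w from CoprodI.Word.equiv.apply_symm_apply w]

/-- Right multiplication by a letter acts at the end of the reduced word, so it reaches a first
letter in factor `i` only when the word lies in that factor. -/
theorem firstLetter_mul_of {i j : I} (g : CoprodI M) (x : M j)
    (h : i ≠ j ∨ g ∉ (CoprodI.of : M i →* CoprodI M).range) :
    firstLetter i (g * CoprodI.of x) = firstLetter i g := by
  have hof : ∀ {i k : I}, i ≠ k → ∀ m : M i, firstLetter k (CoprodI.of m : CoprodI M) = 1 := by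
    intro i k hik m
    have h1 : firstLetter i (CoprodI.of m : CoprodI M) = m := by
      simpa [firstLetter_one] using firstLetter_of_mul i m 1
    by_cases hm : m = 1
    · rw [hm, map_one, firstLetter_one]
    · exact firstLetter_eq_one _ hik (by rwa [h1])
  induction g using firstLetter_induction generalizing i j with
  | one =>
    rw [one_mul, firstLetter_one]
    exact hof (h.resolve_right fun h => h (one_mem _)).symm x
  | mul k m g hm hg ih =>
    rw [mul_assoc]
    by_cases hik : k = i
    · subst hik
      rw [firstLetter_of_mul, firstLetter_of_mul, ih x]
      refine h.imp_right fun h hg => h (mul_mem ⟨m, rfl⟩ hg)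
    · have h1 : firstLetter i (CoprodI.of m * g) = 1 :=
        firstLetter_eq_one (i := k) _ hik (by rwa [firstLetter_of_mul, hg, mul_one])
      rw [h1]
      -- Either the product still begins with `m`, or `g` and `x` both lie in factor `k` and so does
      -- the product.
      by_cases hc : k ≠ j ∨ g ∉ (CoprodI.of : M k →* CoprodI M).range
      · exact firstLetter_eq_one (i := k) _ hik
          (by rwa [firstLetter_of_mul, ih x hc, hg, mul_one])
      · rw [not_or, not_not, not_not] at hc
        obtain ⟨rfl, m', rfl⟩ := hc
        rw [← map_mul, ← map_mul]
        exact hof hik _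

end NormalForm

/-! ### The induced presentation and the free product -/

section Presentation

open Monoid

variable {I : Type*} {X : I → Type*} (R : ∀ i, Set (FreeGroup (X i)))

/-- The inclusion of a factor in the free product given by the induced presentation. -/
def factorHom (i : I) : PresentedGroup (R i) →* PresentedGroup (freeProductRels R) :=
  PresentedGroup.toGroup (f := fun x => PresentedGroup.of ⟨i, x⟩) fun r hr => by
    have h1 : FreeGroup.map (Sigma.mk i) r ∈ freeProductRels R :=
      Set.mem_iUnion.2 ⟨i, r, hr, rfl⟩
    have h2 := PresentedGroup.one_of_mem h1
    have h3 : (PresentedGroup.mk (freeProductRels R)).comp (FreeGroup.map (Sigma.mk i)) =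
        FreeGroup.lift fun x => PresentedGroup.of ⟨i, x⟩ := by
      ext x
      simp [PresentedGroup.of]
    rw [← h3]
    exact h2

theorem factorHom_of (i : I) (x : X i) :
    factorHom R i (PresentedGroup.of x) = PresentedGroup.of ⟨i, x⟩ :=
  PresentedGroup.toGroup.of _

/-- The map from the induced presentation to the free product. -/
def toCoprodI : PresentedGroup (freeProductRels R) →* CoprodI fun i => PresentedGroup (R i) :=
  PresentedGroup.toGroup (f := fun x : Σ i, X i =>
      (CoprodI.of (M := fun i => PresentedGroup (R i)) (i := x.1) (PresentedGroup.of x.2))) fun r hr => by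
    obtain ⟨i, r, hi, rfl⟩ := Set.mem_iUnion.1 hr
    have h3 : (FreeGroup.lift fun x : Σ i, X i =>
          CoprodI.of (M := fun i => PresentedGroup (R i)) (i := x.1) (PresentedGroup.of x.2)).comp
          (FreeGroup.map (Sigma.mk i)) =
        (CoprodI.of (M := fun i => PresentedGroup (R i)) (i := i)).comp (PresentedGroup.mk (R i)) := by
      ext x
      simp [PresentedGroup.of]
    have h4 := DFunLike.congr_fun h3 r
    simp only [MonoidHom.comp_apply] at h4
    rw [h4, PresentedGroup.one_of_mem hi, map_one]

theorem toCoprodI_factorHom (i : I) (m : PresentedGroup (R i)) :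
    toCoprodI R (factorHom R i m) = CoprodI.of (M := fun i => PresentedGroup (R i)) m := by
  have : (toCoprodI R).comp (factorHom R i) =
      CoprodI.of (M := fun i => PresentedGroup (R i)) (i := i) := by
    ext x
    simp only [MonoidHom.comp_apply, factorHom_of]
    exact PresentedGroup.toGroup.of _
  exact DFunLike.congr_fun this m

theorem toCoprodI_injective : Function.Injective (toCoprodI R) := by
  have : (CoprodI.lift (factorHom R)).comp (toCoprodI R) = MonoidHom.id _ := by
    ext x
    simp only [MonoidHom.comp_apply, MonoidHom.id_apply]
    rw [← factorHom_of R x.1 x.2, toCoprodI_factorHom, CoprodI.lift_of]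
  exact Function.LeftInverse.injective (DFunLike.congr_fun this)

/-- Normal forms in the free product given by the induced presentation. -/
def normalFormHead : NormalFormHead (factorHom R) where
  head i g := firstLetter (M := fun i => PresentedGroup (R i)) i (toCoprodI R g)
  head_one i := by rw [map_one, firstLetter_one]
  head_of_mul i m g := by rw [map_mul, toCoprodI_factorHom, firstLetter_of_mul]
  head_eq_one g h hg := firstLetter_eq_one _ h hg
  head_mul_of {i j} g x h := by
    rw [map_mul, toCoprodI_factorHom]
    refine firstLetter_mul_of (M := fun i => PresentedGroup (R i)) _ x (h.imp_right ?_)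
    rintro hg ⟨m, hm⟩
    exact hg ⟨m, toCoprodI_injective R (by rw [toCoprodI_factorHom, hm])⟩

theorem Xi_freeProductRels [Fintype I] [∀ i, Fintype (X i)]
    (hnt : ∀ i, Nontrivial (PresentedGroup (R i))) (hred : ∀ i, IsReduced (gens (R i)))
    {i₁ i₂ : I} (hne : i₁ ≠ i₂) (h₁₂ : Psi (gens (R i₂)) ≤ Psi (gens (R i₁)))
    (hle : ∀ j ≠ i₁, Psi (gens (R j)) ≤ Psi (gens (R i₂))) :
    Xi (gens (freeProductRels R)) = profile (gens (R i₁)) (Psi (gens (R i₂))) :=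
  (normalFormHead R).Xi_eq_profile (γ := fun i => gens (R i))
    (fun x => (factorHom_of R x.1 x.2).symm) (PresentedGroup.closure_range_of _) hne hred h₁₂ hle

end Presentation
end
end CycQuot

/-! ### The main theorem -/

open CycQuot in
theorem theorem5p3
    (r : ℕ) (hr : 2 ≤ r)
    (X : Fin r → Type*) [∀ i, Fintype (X i)]
    (R : ∀ i, Set (FreeGroup (X i)))
    (hnontrivial : ∀ i, Nontrivial (PresentedGroup (R i)))
    (hreduced : ∀ i, IsReduced (gens (R i)))
    (hanti : ∀ i j : Fin r, i ≤ j → Psi (gens (R j)) ≤ Psi (gens (R i)))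
    (i₁ i₂ : Fin r) (hi₁ : i₁ = Fin.castLE hr 0) (hi₂ : i₂ = Fin.castLE hr 1) :
    -- part (i)
    (Psi (gens (R i₁)) = Xi (gens (R i₁)) →
      XiHat (gens (freeProductRels R)) =
        1 - (∑ i, (Fintype.card (X i) : ℝ)) + Xi (gens (R i₁))) ∧
    -- part (ii)
    (Psi (gens (R i₁)) ≠ Xi (gens (R i₁)) →
      Xi (gens (R i₁)) < Psi (gens (R i₁)) ∧
      XiHat (gens (freeProductRels R)) =
        1 - (∑ i, (Fintype.card (X i) : ℝ)) +
          Xi (gens (freeProductRels (fun j : Fin 2 => R (Fin.castLE hr j)))) ∧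
      (∃ Y : Finset (X i₁),
        Finite (Gp (gens (R i₁)) Y) ∧ Nontrivial (Gp (gens (R i₁)) Y) ∧
        Psi (gens (R i₁)) = Psi (subGen (gens (R i₁)) Y) ∧
        XiHat (gens (freeProductRels R)) =
          1 - (∑ i, (Fintype.card (X i) : ℝ)) +
            max (Xi (gens (R i₁)))
              (Xi (subGen (gens (R i₁)) Y) +
                Psi (gens (R i₂)) / (Nat.card (Gp (gens (R i₁)) Y) : ℝ))) ∧
      (∀ Y : Finset (X i₁), IsExtremal (gens (R i₁)) Y →
        Psi (gens (R i₁)) = Psi (subGen (gens (R i₁)) Y) →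
        Psi (subGen (gens (R i₁)) Y) =
          (Y.card : ℝ) - 1 + (Y.card : ℝ) / ((Nat.card (Gp (gens (R i₁)) Y) : ℝ) - 1) →
        XiHat (gens (freeProductRels R)) =
          1 - (∑ i, (Fintype.card (X i) : ℝ)) +
            max (Xi (gens (R i₁)))
              (Xi (subGen (gens (R i₁)) Y) +
                Psi (gens (R i₂)) / (Nat.card (Gp (gens (R i₁)) Y) : ℝ))) ∧
      (IsMinimal (gens (R i₁)) →
        ∀ Y : Finset (X i₁), IsExtremal (gens (R i₁)) Y →
          Psi (gens (R i₁)) = Psi (subGen (gens (R i₁)) Y) ∧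
          Psi (subGen (gens (R i₁)) Y) =
            (Y.card : ℝ) - 1 +
              (Y.card : ℝ) / ((Nat.card (Gp (gens (R i₁)) Y) : ℝ) - 1))) := by
  have hgen : Subgroup.closure (Set.range (gens (R i₁))) = ⊤ := PresentedGroup.closure_range_of _
  have hred := hreduced i₁
  have h12 : i₁ ≤ i₂ := by rw [hi₁, hi₂, Fin.le_def]; simp
  have hne : i₁ ≠ i₂ := by rw [hi₁, hi₂, Ne, Fin.ext_iff]; simp
  have hle : ∀ j ≠ i₁, Psi (gens (R j)) ≤ Psi (gens (R i₂)) := by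
    intro j hj
    refine hanti i₂ j ?_
    rw [hi₁, Ne, Fin.ext_iff] at hj
    rw [hi₂, Fin.le_def]
    simp at hj ⊢
    omega
  have hΨ₂ : Psi (gens (R i₂)) ≤ Psi (gens (R i₁)) := hanti _ _ h12
  have h0 : 0 ≤ Psi (gens (R i₂)) := by
    have := hnontrivial i₂
    exact Psi_nonneg
  have hhat : XiHat (gens (freeProductRels R)) = 1 - (∑ i, (Fintype.card (X i) : ℝ)) +
      profile (gens (R i₁)) (Psi (gens (R i₂))) := by
    rw [XiHat, Xi_freeProductRels R hnontrivial hreduced hne hΨ₂ hle, Fintype.card_sigma,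
      Nat.cast_sum]
  have := hnontrivial i₁
  refine ⟨fun h => ?_, fun h => ?_⟩
  · rw [hhat, profile_eq_Xi hred h h0 hΨ₂]
  have hlt : Xi (gens (R i₁)) < Psi (gens (R i₁)) :=
    lt_of_le_of_ne ((Xi_le_profile (h0.trans hΨ₂)).trans (profile_Psi_le hred)) h.symm
  refine ⟨hlt, ?_, ?_, ?_, ?_⟩
  -- The profile formula involves only the first two factors, so it gives the same value for their
  -- free product.
  · rw [hhat, Xi_freeProductRels (fun j : Fin 2 => R (Fin.castLE hr j)) (fun j => hnontrivial _)
      (fun j => hreduced _) (zero_ne_one : (0 : Fin 2) ≠ 1) (by rw [← hi₁, ← hi₂]; exact hΨ₂)]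
    · subst hi₁ hi₂
      rfl
    · intro j hj
      exact hanti _ _ ((Fin.castLE_le_castLE_iff hr).2 (by omega))
  · obtain ⟨Y, h1, h2, h3, h4⟩ := exists_profile_eq hgen hred hlt h0 hΨ₂
    exact ⟨Y, h1, h2, h3, by rw [hhat, h4]⟩
  · intro Y hY h1 h2
    rw [hhat, profile_eq_of_isExtremal hgen hred h0 hΨ₂ hY (h1.trans h2)]
  · intro hmin Y hY
    exact Psi_eq_of_isMinimal hgen hred hlt hmin hY
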